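/- There is a universal constant $C>0$ such that the following holds. Let $p\in[2,\infty)$ be a real number, let $d\ge 1$ be an integer, let $\mathcal C$ be a set of $n$ points in $\ell_p^d$ (that is, $\mathbb R^d$ with the metric $\|x-y\|_p$), and let $\Delta>0$. Then there exists a $(\beta,\Delta)$-Lipschitz decomposition of $\mathcal C$ with $$\beta = C\,p^4\sqrt{\min\{\log n,\,d\}} .$$ Here a $(\beta,\Delta)$-Lipschitz decomposition of a finite metric space $(M,\rho)$ is a probability distribution $\mathcal D$ over partitions of $M$ such that (i) for every partition $P$ in the support of $\mathcal D$, every cluster $K\in P$ has diameter $\sup_{x,y\in K}\rho(x,y)\le\Delta$; and (ii) for all $x,y\in M$, $$\Pr_{P\sim\mathcal D}[P(x)\ne P(y)]\le \beta\,\frac{\rho(x,y)}{\Delta},$$ where $P(z)$ denotes the cluster of $P$ that contains $z$. -/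

import Mathlib

open scoped NNReal ENNReal

namespace LipDecomp

/-- The cluster `P(z)` of the partition `P` that contains the point `z`. A partition of `M` is
encoded by the equivalence relation of lying in the same cluster; its set of clusters is
`Setoid.classes P`. -/
def cluster {M : Type*} (P : Setoid M) (z : M) : Set M := {w | P w z}

/-- A probability distribution `D` on the partitions of a metric space `M` (for a finite `M` there
are finitely many partitions, so every distribution on them is a `PMF`) is a
`(β, Δ)`-Lipschitz decomposition if all clusters of all partitions in its support have diameter at
most `Δ` and every two points `x, y` are separated with probability at most `β * dist x y / Δ`. -/
structure IsLipschitzDecomposition {M : Type*} [MetricSpace M] (β Δ : ℝ)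
    (D : PMF (Setoid M)) : Prop where
  diam_le : ∀ P ∈ D.support, ∀ K ∈ P.classes, Metric.ediam K ≤ ENNReal.ofReal Δ
  prob_le : ∀ x y : M,
    (D.toOuterMeasure {P | cluster P x ≠ cluster P y}).toReal ≤ β * (dist x y / Δ)

end LipDecomp

/-! ### Random partitions and their refinement. -/

namespace LipDecomp

/-! The case `p = 2` is proved directly and then carried to larger `p` by Mazur maps.

In a `d`-dimensional Euclidean space, random sets carve clusters out one after another. Two points
are separated with probability at most the measure of the symmetric difference of their capture
regions relative to the measure of one region (`decomposable_of_measure`). Taking the regions to be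
hypographs of translates of a truncated Gaussian of width about `Δ / √d` gives `O(√d)`
(`decomposable_euclidean`). A random sign matrix with `O(log n)` rows shrinks no pair too much with
probability at least `1/2` and expands each pair by a controlled factor on average, so `d` can be
replaced by `log n` (`decomposable_euclidean_log`).

The Mazur map with exponent `s` sends `ℓ_p` to `ℓ_q`, where `p = s * q`. It is Lipschitz on the unit
ball and its inverse is Hölder. A cluster of diameter `2 * Δ` can therefore be recentred, rescaled
into the unit ball, mapped, and split into clusters of diameter `Δ` by a decomposition in `ℓ_q`.
Descending through the scales, the separation probabilities form a geometric series, and the whole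
passage costs a factor `16 * 2 ^ (1 / q - 1 / p)` if `s ≤ 2` (`Separable.of_mazur`). The loss is
exponential in `s`, so `p` is halved repeatedly instead of going to `2` at once: each halving
contributes `16 = 2 ^ 4`, whence `p ^ 4`, while the other factors telescope to a bounded one
(`separable_of_two`). -/

/-- `Decomposable close sep` says that some random partition has only clusters of pairwise close
points and separates any two points `x, y` with probability at most `sep x y`. -/
def Decomposable {ι : Type*} (close : ι → ι → Prop) (sep : ι → ι → ℝ≥0∞) : Prop :=
  ∃ D : PMF (Setoid ι), (∀ P ∈ D.support, ∀ x y, P x y → close x y) ∧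
    ∀ x y, D.toOuterMeasure {P | ¬ P x y} ≤ sep x y

lemma toOuterMeasure_le_one {α : Type*} (D : PMF α) (s : Set α) : D.toOuterMeasure s ≤ 1 := by
  rw [PMF.toOuterMeasure_apply, ← D.tsum_coe]
  exact ENNReal.tsum_le_tsum fun a => Set.indicator_le_self _ _ a

lemma Decomposable.mono {ι : Type*} {close close' : ι → ι → Prop} {sep sep' : ι → ι → ℝ≥0∞}
    (h : Decomposable close sep) (hc : ∀ x y, close x y → close' x y)
    (hs : ∀ x y, sep x y ≤ sep' x y) : Decomposable close' sep' := by
  obtain ⟨D, h1, h2⟩ := h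
  exact ⟨D, fun P hP x y hxy => hc x y (h1 P hP x y hxy), fun x y => (h2 x y).trans (hs x y)⟩

lemma decomposable_of_forall_close {ι : Type*} {close : ι → ι → Prop} (sep : ι → ι → ℝ≥0∞)
    (h : ∀ x y, close x y) : Decomposable close sep := by
  refine ⟨PMF.pure ⊤, fun P _ x y _ => h x y, fun x y => ?_⟩
  rw [PMF.toOuterMeasure_pure_apply, if_neg fun h => h trivial]
  exact zero_le

/-- Coordinates are resampled one at a time. Only the marginals matter later, so independence is not
recorded. -/
lemma exists_pmf_pi {ι α : Type*} [Finite ι] [DecidableEq ι] [Nonempty α] (D : ι → PMF α) :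
    ∃ E : PMF (ι → α), ∀ i, E.map (fun g => g i) = D i := by
  have := Fintype.ofFinite ι
  suffices h : ∀ s : Finset ι, ∃ E : PMF (ι → α), ∀ i ∈ s, E.map (fun g => g i) = D i by
    obtain ⟨E, hE⟩ := h Finset.univ
    exact ⟨E, fun i => hE i (Finset.mem_univ i)⟩
  intro s
  induction s using Finset.induction_on with
  | empty => exact ⟨PMF.pure fun _ => Classical.arbitrary α, by simp⟩
  | insert a s ha ih =>
    obtain ⟨E, hE⟩ := ih
    refine ⟨E.bind fun g => (D a).map (Function.update g a), fun i hi => ?_⟩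
    rw [PMF.map_bind]
    by_cases hia : i = a
    · subst hia
      simp only [PMF.map_comp, Function.comp_def, Function.update_self]
      have : PMF.map (fun x : α => x) (D i) = D i := PMF.map_id _
      rw [this, PMF.bind_const]
    · have his : i ∈ s := (Finset.mem_insert.1 hi).resolve_left hia
      simp only [PMF.map_comp, Function.comp_def, Function.update_of_ne hia]
      rw [← hE i his]
      refine congrArg (PMF.bind E) (funext fun g => ?_)
      exact PMF.map_const _ _

/-- The common refinement of `P` and a family of partitions, where a cluster of `P` is subdivided
according to the member of the family indexed by its representative. -/
def refineSetoid {ι : Type*} (P : Setoid ι) (g : ι → Setoid ι) : Setoid ι where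
  r x y := P x y ∧ g (Quotient.mk P x).out x y
  iseqv :=
    { refl := fun x => ⟨P.refl x, (g _).refl x⟩
      symm := by
        rintro x y ⟨h1, h2⟩
        refine ⟨P.symm h1, ?_⟩
        rw [← (Quotient.sound h1 : Quotient.mk P x = Quotient.mk P y)]
        exact (g _).symm h2
      trans := by
        rintro x y z ⟨h1, h2⟩ ⟨h3, h4⟩
        refine ⟨P.trans h1 h3, ?_⟩
        rw [← (Quotient.sound h1 : Quotient.mk P x = Quotient.mk P y)] at h4
        exact (g _).trans h2 h4 }

/-- All points of a cluster are close to its representative `c`, so the second partition needs to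
behave well only near `c`; the value `∞` imposes nothing elsewhere. A pair is separated either by
the first partition or, inside a common cluster, by the second, and the two probabilities add. -/
lemma Decomposable.refine {ι : Type*} [Finite ι] {close close' : ι → ι → Prop}
    {sep sep' : ι → ι → ℝ≥0∞} (h : Decomposable close sep)
    (h' : ∀ c, Decomposable (fun x y => close x c → close y c → close' x y)
      (fun x y => open Classical in if close x c ∧ close y c then sep' x y else ∞)) :
    Decomposable close' (fun x y => sep x y + sep' x y) := by
  classical
  obtain ⟨D, hD1, hD2⟩ := h
  choose F hF1 hF2 using h'
  have : Nonempty (Setoid ι) := ⟨⊤⟩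
  obtain ⟨E, hE⟩ := exists_pmf_pi F
  refine ⟨D.bind fun P => E.map (refineSetoid P), ?_, ?_⟩
  · intro Q hQ x y hxy
    rw [PMF.mem_support_bind_iff] at hQ
    obtain ⟨P, hP, hQ⟩ := hQ
    rw [PMF.mem_support_map_iff] at hQ
    obtain ⟨g, hg, rfl⟩ := hQ
    set c := (Quotient.mk P x).out with hc
    have hcx : P c x := Quotient.mk_out x
    have hgc : g c ∈ (F c).support := by
      rw [← hE c, PMF.mem_support_map_iff]; exact ⟨g, hg, rfl⟩
    exact hF1 c _ hgc x y hxy.2 (hD1 P hP _ _ (P.symm hcx))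
      (hD1 P hP _ _ (P.trans (P.symm hxy.1) (P.symm hcx)))
  · intro x y
    rw [PMF.toOuterMeasure_bind_apply]
    calc ∑' P, D P * (E.map (refineSetoid P)).toOuterMeasure {P | ¬ P x y}
        ≤ ∑' P, ({P : Setoid ι | ¬ P x y}.indicator D P + D P * sep' x y) := by
          refine ENNReal.tsum_le_tsum fun P => ?_
          by_cases hP : D P = 0
          · simp [hP]
          by_cases hxy : P x y
          · refine le_add_left ?_
            gcongr
            set c := (Quotient.mk P x).out with hc
            have hcx : P c x := Quotient.mk_out x
            have h1 : close x c := hD1 P hP _ _ (P.symm hcx)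
            have h2 : close y c := hD1 P hP _ _ (P.trans (P.symm hxy) (P.symm hcx))
            have := hF2 c x y
            dsimp only at this
            rw [if_pos ⟨h1, h2⟩, ← hE c, PMF.toOuterMeasure_map_apply] at this
            refine le_trans ?_ this
            rw [PMF.toOuterMeasure_map_apply]
            exact MeasureTheory.measure_mono fun g hg hg' => hg ⟨hxy, hg'⟩
          · refine le_add_right ?_
            rw [Set.indicator_of_mem (show P ∈ {P : Setoid ι | ¬ P x y} from hxy)]
            exact mul_le_of_le_one_right' (toOuterMeasure_le_one _ _)
      _ = D.toOuterMeasure {P | ¬ P x y} + sep' x y := by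
          rw [ENNReal.tsum_add, ENNReal.tsum_mul_right, D.tsum_coe, one_mul,
            PMF.toOuterMeasure_apply]
      _ ≤ sep x y + sep' x y := add_le_add_left (hD2 x y) _

/-! ### Carving clusters out by random sets. -/

/-- The partition that has `K` as a cluster and agrees with `P` on the complement of `K`. -/
def glueSetoid {ι : Type*} (K : Set ι) (P : Setoid ι) : Setoid ι where
  r x y := (x ∈ K ∧ y ∈ K) ∨ (x ∉ K ∧ y ∉ K ∧ P x y)
  iseqv :=
    { refl := fun x => by
        by_cases h : x ∈ K
        · exact Or.inl ⟨h, h⟩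
        · exact Or.inr ⟨h, h, P.refl x⟩
      symm := by
        rintro x y (h | h)
        · exact Or.inl h.symm
        · exact Or.inr ⟨h.2.1, h.1, P.symm h.2.2⟩
      trans := by
        rintro x y z (h | h) (h' | h')
        · exact Or.inl ⟨h.1, h'.2⟩
        · exact absurd h.2 h'.1
        · exact absurd h'.1 h.2.1
        · exact Or.inr ⟨h.1, h'.2.1, P.trans h.2.2 h'.2.2⟩ }

-- Draw `A` with probability proportional to its weight, make `A ∩ T` a cluster, and recurse on the
-- rest of `T`. A pair is separated now if `A` contains exactly one of its points, and later with
-- probability at most `θ x y` if `A` misses both. By `hsep` the first event has at most `θ x y`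
-- times the mass of the sets meeting the pair, so the bound `θ x y` is reproduced. Points outside
-- `T` are singletons.
open Classical in
lemma exists_carving_on {ι : Type*} [Finite ι] {close : ι → ι → Prop} {θ : ι → ι → ℝ≥0∞}
    (w : Set ι → ℝ≥0∞) (hfin : ∀ A, w A ≠ ∞) (hpos : ∀ x, ∃ A, x ∈ A ∧ w A ≠ 0)
    (hclose : ∀ A, w A ≠ 0 → ∀ x ∈ A, ∀ y ∈ A, close x y)
    (hsep : ∀ x y, ∑' A, (if (x ∈ A ↔ y ∈ A) then 0 else w A) ≤
      θ x y * ∑' A, (if x ∈ A ∨ y ∈ A then w A else 0)) (T : Finset ι) :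
    ∃ D : PMF (Setoid ι),
      (∀ P ∈ D.support, ∀ x y, P x y → x = y ∨ x ∈ T ∧ y ∈ T ∧ close x y) ∧
      ∀ x ∈ T, ∀ y ∈ T, D.toOuterMeasure {P | ¬ P x y} ≤ θ x y := by
  induction T using Finset.strongInduction with
  | H T ih =>
  rcases T.eq_empty_or_nonempty with rfl | ⟨z, hz⟩
  · refine ⟨PMF.pure ⊥, fun P hP x y hxy => ?_, by simp⟩
    rw [PMF.mem_support_pure_iff] at hP
    subst hP
    exact Or.inl hxy
  have := Fintype.ofFinite (Set ι)
  -- Conditioning on `A` meeting `T` makes every draw remove a point, so the recursion is finite.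
  let v : Set ι → ℝ≥0∞ := fun A => if ∃ x ∈ T, x ∈ A then w A else 0
  have hv : ∀ A, v A = if ∃ x ∈ T, x ∈ A then w A else 0 := fun _ => rfl
  have hv0 : tsum v ≠ 0 := by
    obtain ⟨A, hzA, hA⟩ := hpos z
    rw [Ne, ENNReal.tsum_eq_zero]
    intro h
    have := h A
    rw [if_pos ⟨z, hz, hzA⟩] at this
    exact hA this
  have hvt : tsum v ≠ ∞ := by
    rw [tsum_fintype]
    refine ENNReal.sum_ne_top.2 fun A _ => ?_
    split_ifs
    · exact hfin A
    · simp
  have hD : ∀ A : Set ι, ∃ D : PMF (Setoid ι), (∃ x ∈ T, x ∈ A) →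
      (∀ P ∈ D.support, ∀ x y, P x y →
        x = y ∨ (x ∈ T ∧ x ∉ A) ∧ (y ∈ T ∧ y ∉ A) ∧ close x y) ∧
      ∀ x ∈ T, x ∉ A → ∀ y ∈ T, y ∉ A → D.toOuterMeasure {P | ¬ P x y} ≤ θ x y := by
    intro A
    by_cases hA : ∃ x ∈ T, x ∈ A
    · obtain ⟨x, hxT, hxA⟩ := hA
      obtain ⟨D, h1, h2⟩ := ih (T.filter (· ∉ A))
        (Finset.filter_ssubset.2 ⟨x, hxT, by simpa using hxA⟩)
      refine ⟨D, fun _ => ⟨fun P hP x y hxy => ?_, fun x hx hxA y hy hyA => ?_⟩⟩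
      · simpa only [Finset.mem_filter] using h1 P hP x y hxy
      · exact h2 x (Finset.mem_filter.2 ⟨hx, hxA⟩) y (Finset.mem_filter.2 ⟨hy, hyA⟩)
    · exact ⟨PMF.pure ⊥, fun h => absurd h hA⟩
  choose F hF using hD
  have hvA : ∀ A, v A ≠ 0 → (∃ x ∈ T, x ∈ A) ∧ w A ≠ 0 := by
    intro A hA
    by_cases h : ∃ x ∈ T, x ∈ A
    · rw [hv, if_pos h] at hA
      exact ⟨h, hA⟩
    · rw [hv, if_neg h] at hA
      exact absurd rfl hA
  refine ⟨(PMF.normalize v hv0 hvt).bind fun A => (F A).map (glueSetoid (A ∩ T)), ?_, ?_⟩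
  · intro Q hQ x y hxy
    rw [PMF.mem_support_bind_iff] at hQ
    obtain ⟨A, hA, hQ⟩ := hQ
    rw [PMF.mem_support_map_iff] at hQ
    obtain ⟨P, hP, rfl⟩ := hQ
    rw [PMF.mem_support_normalize_iff] at hA
    obtain ⟨hA1, hA2⟩ := hvA A hA
    rcases hxy with ⟨hx, hy⟩ | ⟨_, _, hxy⟩
    · exact Or.inr ⟨hx.2, hy.2, hclose A hA2 x hx.1 y hy.1⟩
    · rcases (hF A hA1).1 P hP x y hxy with h | h
      · exact Or.inl h
      · exact Or.inr ⟨h.1.1, h.2.1.1, h.2.2⟩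
  · intro x hx y hy
    rw [PMF.toOuterMeasure_bind_apply]
    have key : ∀ A, v A * ((F A).map (glueSetoid (A ∩ T))).toOuterMeasure {P | ¬ P x y} ≤
        (if (x ∈ A ↔ y ∈ A) then 0 else w A) + θ x y * (if x ∈ A ∨ y ∈ A then 0 else v A) := by
      intro A
      by_cases hA : v A = 0
      · simp [hA]
      obtain ⟨hA1, hA2⟩ := hvA A hA
      have hvw : v A = w A := if_pos hA1
      rw [PMF.toOuterMeasure_map_apply]
      by_cases hxA : x ∈ A <;> by_cases hyA : y ∈ A
      · have : (glueSetoid (A ∩ T)) ⁻¹' {P | ¬ P x y} = ∅ := by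
          ext P
          simp only [Set.mem_preimage, Set.mem_ofPred_eq, Set.mem_empty_iff_false, iff_false, not_not]
          exact Or.inl ⟨⟨hxA, hx⟩, ⟨hyA, hy⟩⟩
        simp [this]
      · simp only [hxA, hyA, hvw, iff_false, not_true, if_false, true_or, if_true, mul_zero,
          add_zero]
        exact mul_le_of_le_one_right' (toOuterMeasure_le_one _ _)
      · simp only [hxA, hyA, hvw, false_iff, not_true, if_false, or_true, if_true, mul_zero,
          add_zero]
        exact mul_le_of_le_one_right' (toOuterMeasure_le_one _ _)
      · simp only [hxA, hyA, if_true, or_self, if_false, zero_add]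
        rw [mul_comm]
        gcongr
        refine le_trans (MeasureTheory.measure_mono (t := {P | ¬ P x y}) fun P hP hP' => hP ?_)
          ((hF A hA1).2 x hx hxA y hy hyA)
        exact Or.inr ⟨fun h => hxA h.1, fun h => hyA h.1, hP'⟩
    calc ∑' A, (PMF.normalize v hv0 hvt) A *
          ((F A).map (glueSetoid (A ∩ T))).toOuterMeasure {P | ¬ P x y}
        = (∑' A, v A * ((F A).map (glueSetoid (A ∩ T))).toOuterMeasure {P | ¬ P x y}) *
          (∑' A, v A)⁻¹ := by
          rw [← ENNReal.tsum_mul_right]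
          refine tsum_congr fun A => ?_
          rw [PMF.normalize_apply]; ring
      _ ≤ (∑' A, ((if (x ∈ A ↔ y ∈ A) then 0 else w A) +
            θ x y * (if x ∈ A ∨ y ∈ A then 0 else v A))) * (∑' A, v A)⁻¹ := by
          gcongr with A; exact key A
      _ ≤ (θ x y * ∑' A, v A) * (∑' A, v A)⁻¹ := by
          gcongr
          rw [ENNReal.tsum_add, ENNReal.tsum_mul_left]
          refine (add_le_add_left (hsep x y) _).trans ?_
          rw [← mul_add, ← ENNReal.tsum_add]
          gcongr with A
          by_cases h : x ∈ A ∨ y ∈ A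
          · have : ∃ x ∈ T, x ∈ A := by
              rcases h with h | h
              exacts [⟨x, hx, h⟩, ⟨y, hy, h⟩]
            simp [h, v, this]
          · simp [h]
      _ = θ x y := by
          rw [mul_assoc, ENNReal.mul_inv_cancel hv0 hvt, mul_one]

open MeasureTheory in
/-- Carving by random sets: sampling points `ω` with respect to `ν`, and letting each `ω` capture
the points `x` with `ω ∈ B x` that were not captured before, gives a random partition. -/
lemma decomposable_of_measure {ι Ω : Type*} [Finite ι] [MeasurableSpace Ω] (ν : Measure Ω)
    {close : ι → ι → Prop} {θ : ι → ι → ℝ≥0∞} (B : ι → Set Ω) (hB : ∀ x, MeasurableSet (B x))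
    (hpos : ∀ x, ν (B x) ≠ 0) (hfin : ∀ x, ν (B x) ≠ ∞)
    (hclose : ∀ ω x y, ω ∈ B x → ω ∈ B y → close x y)
    (hsep : ∀ x y, ν (B x \ B y) + ν (B y \ B x) ≤ θ x y * ν (B x)) :
    Decomposable close θ := by
  classical
  have := Fintype.ofFinite ι
  have := Fintype.ofFinite (Set ι)
  -- Only the set of points captured by `ω` matters; it takes finitely many values, which reduces
  -- the claim to weights on subsets of `ι`.
  let cell : Set ι → Set Ω := fun A => {ω | ∀ x, x ∈ A ↔ ω ∈ B x}
  have hcell : ∀ A, MeasurableSet (cell A) := by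
    intro A
    have : cell A = ⋂ x, {ω | x ∈ A ↔ ω ∈ B x} := by ext; simp [cell]
    rw [this]
    refine MeasurableSet.iInter fun x => ?_
    by_cases hx : x ∈ A
    · simpa [hx] using hB x
    · have : {ω | x ∈ A ↔ ω ∈ B x} = (B x)ᶜ := by ext; simp [hx]
      rw [this]
      exact (hB x).compl
  have hdisj : Pairwise (Function.onFun Disjoint cell) := by
    intro A A' hne
    rw [Function.onFun, Set.disjoint_left]
    intro ω h h'
    exact hne (Set.ext fun x => (h x).trans (h' x).symm)
  have hsum : ∀ (q : Set ι → Prop) (X : Set Ω), (∀ ω, ω ∈ X ↔ q {x | ω ∈ B x}) →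
      ∑' A, (if q A then ν (cell A) else 0) = ν X := by
    intro q X hX
    have : X = ⋃ A, (if q A then cell A else ∅) := by
      ext ω
      rw [hX, Set.mem_iUnion]
      constructor
      · intro h
        exact ⟨_, by rw [if_pos h]; exact fun x => Iff.rfl⟩
      · rintro ⟨A, hA⟩
        split_ifs at hA with h
        · have : A = {x | ω ∈ B x} := Set.ext hA
          rwa [← this]
        · exact absurd hA (Set.notMem_empty _)
    rw [this, measure_iUnion]
    · refine tsum_congr fun A => ?_
      split_ifs <;> simp
    · intro A A' hne
      rw [Function.onFun]
      split_ifs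
      · exact hdisj hne
      all_goals simp
    · intro A
      split_ifs
      exacts [hcell A, MeasurableSet.empty]
  -- The empty set gets weight zero because its cell, the `ω` capturing nothing, may have infinite
  -- measure.
  let w : Set ι → ℝ≥0∞ := fun A => if A.Nonempty then ν (cell A) else 0
  have hw : ∀ (A : Set ι) (x : ι), x ∈ A → w A = ν (cell A) := fun A x hx => if_pos ⟨x, hx⟩
  have hposw : ∀ x, ∃ A, x ∈ A ∧ w A ≠ 0 := by
    intro x
    by_contra! h
    refine hpos x ?_
    rw [← hsum (fun A => x ∈ A) (B x) (fun ω => Iff.rfl), ENNReal.tsum_eq_zero]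
    intro A
    split_ifs with hA
    · rw [← hw A x hA, h A hA]
    · rfl
  have hfinw : ∀ A, w A ≠ ∞ := by
    intro A
    simp only [w]
    split_ifs with h
    · obtain ⟨x, hx⟩ := h
      exact measure_ne_top_of_subset (fun ω hω => (hω x).1 hx) (hfin x)
    · simp
  have hclosew : ∀ A, w A ≠ 0 → ∀ x ∈ A, ∀ y ∈ A, close x y := by
    intro A hA x hx y hy
    rw [hw A x hx] at hA
    obtain ⟨ω, hω⟩ := nonempty_of_measure_ne_zero hA
    exact hclose ω x y ((hω x).1 hx) ((hω y).1 hy)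
  have hsepw : ∀ x y, ∑' A, (if (x ∈ A ↔ y ∈ A) then 0 else w A) ≤
      θ x y * ∑' A, (if x ∈ A ∨ y ∈ A then w A else 0) := by
    intro x y
    have e1 : ∑' A, (if (x ∈ A ↔ y ∈ A) then 0 else w A) = ν ((B x \ B y) ∪ (B y \ B x)) := by
      rw [← hsum (fun A => ¬ (x ∈ A ↔ y ∈ A))]
      · refine tsum_congr fun A => ?_
        by_cases hx : x ∈ A <;> by_cases hy : y ∈ A <;> simp [hx, hy]
        exacts [hw A x hx, hw A y hy]
      · intro ω
        simp only [Set.mem_union, Set.mem_sdiff, Set.mem_ofPred_eq]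
        tauto
    have e2 : ∑' A, (if x ∈ A ∨ y ∈ A then w A else 0) = ν (B x ∪ B y) := by
      rw [← hsum (fun A => x ∈ A ∨ y ∈ A)]
      · refine tsum_congr fun A => ?_
        by_cases hx : x ∈ A <;> by_cases hy : y ∈ A <;> simp [hx, hy]
        exacts [hw A x hx, hw A x hx, hw A y hy]
      · intro ω
        rfl
    rw [e1, e2]
    refine (measure_union_le _ _).trans ((hsep x y).trans ?_)
    gcongr
    exact Set.subset_union_left
  obtain ⟨D, h1, h2⟩ := exists_carving_on w hfinw hposw hclosew hsepw Finset.univ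
  refine ⟨D, fun P hP x y hxy => ?_, fun x y => h2 x (Finset.mem_univ _) y (Finset.mem_univ _)⟩
  rcases h1 P hP x y hxy with rfl | h
  · have : (B x).Nonempty := nonempty_of_measure_ne_zero (hpos x)
    obtain ⟨ω, hω⟩ := this
    exact hclose ω x x hω hω
  · exact h.2.2

/-! ### Euclidean space: the bound in terms of the dimension. -/

section Euclidean

open MeasureTheory

lemma measure_prod_sdiff_hypograph_le {V : Type*} [MeasurableSpace V] (μ : Measure V)
    [SFinite μ] {g g' : V → ℝ} (hg : Measurable g) (hg' : Measurable g') :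
    (μ.prod volume) ({z : V × ℝ | 0 < z.2 ∧ z.2 < g z.1} \ {z : V × ℝ | 0 < z.2 ∧ z.2 < g' z.1}) ≤
      ∫⁻ u, ENNReal.ofReal |g u - g' u| ∂μ := by
  have hm : ∀ {k : V → ℝ}, Measurable k →
      MeasurableSet {z : V × ℝ | 0 < z.2 ∧ z.2 < k z.1} := fun hk =>
    (measurableSet_lt measurable_const measurable_snd).inter
      (measurableSet_lt measurable_snd (hk.comp measurable_fst))
  rw [Measure.prod_apply ((hm hg).diff (hm hg'))]
  refine lintegral_mono fun u => ?_
  have : Prod.mk u ⁻¹' ({z : V × ℝ | 0 < z.2 ∧ z.2 < g z.1} \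
      {z : V × ℝ | 0 < z.2 ∧ z.2 < g' z.1}) ⊆ Set.Icc (g' u) (g u) := by
    rintro τ ⟨⟨h1, h2⟩, h3⟩
    refine ⟨?_, le_of_lt h2⟩
    by_contra! h
    exact h3 ⟨h1, h⟩
  refine (measure_mono this).trans ?_
  rw [Real.volume_Icc]
  exact ENNReal.ofReal_le_ofReal (le_abs_self _)

lemma measure_prod_hypograph {V : Type*} [MeasurableSpace V] (μ : Measure V)
    [SFinite μ] {g : V → ℝ} (hg : Measurable g) :
    (μ.prod volume) {z : V × ℝ | 0 < z.2 ∧ z.2 < g z.1} = ∫⁻ u, ENNReal.ofReal (g u) ∂μ := by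
  have hm : MeasurableSet {z : V × ℝ | 0 < z.2 ∧ z.2 < g z.1} :=
    (measurableSet_lt measurable_const measurable_snd).inter
      (measurableSet_lt measurable_snd (hg.comp measurable_fst))
  rw [Measure.prod_apply hm]
  refine lintegral_congr fun u => ?_
  have : Prod.mk u ⁻¹' {z : V × ℝ | 0 < z.2 ∧ z.2 < g z.1} = Set.Ioo 0 (g u) := rfl
  rw [this, Real.volume_Ioo, sub_zero]

/-- A cutoff equal to `1` on the ball of radius `r / 2` and to `0` outside the ball of radius
`r`. -/
noncomputable def cutoff {V : Type*} [NormedAddCommGroup V] (r : ℝ) (v : V) : ℝ := max 0 (min 1 (2 - 2 * ‖v‖ / r))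

lemma abs_cutoff_sub_le {V : Type*} [NormedAddCommGroup V] {r : ℝ} (hr : 0 < r) (v w : V) :
    |cutoff r v - cutoff r w| ≤ 2 * ‖v - w‖ / r := by
  unfold cutoff
  rw [max_comm, max_comm 0]
  refine (abs_max_sub_max_le_abs _ _ _).trans ?_
  rw [min_comm, min_comm 1]
  refine (abs_min_sub_min_le_max _ _ _ _).trans ?_
  rw [sub_self, abs_zero, max_eq_left (abs_nonneg _)]
  have : 2 - 2 * ‖v‖ / r - (2 - 2 * ‖w‖ / r) = 2 * (‖w‖ - ‖v‖) / r := by ring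
  rw [this, abs_div, abs_mul, abs_of_pos hr, abs_two]
  gcongr
  rw [norm_sub_rev]
  exact abs_norm_sub_norm_le _ _

variable {V : Type*} [NormedAddCommGroup V] [InnerProductSpace ℝ V] [FiniteDimensional ℝ V]
  [MeasurableSpace V] [BorelSpace V]

lemma integrable_gaussian {b : ℝ} (hb : 0 < b) :
    Integrable fun v : V => Real.exp (-b * ‖v‖ ^ 2) := by
  by_contra h
  have h1 := GaussianFourier.integral_rexp_neg_mul_sq_norm (V := V) hb
  rw [integral_undef h] at h1
  have : 0 < (Real.pi / b) ^ (Module.finrank ℝ V / 2 : ℝ) := by positivity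
  exact this.ne h1

lemma integral_gaussian_pos {b : ℝ} (hb : 0 < b) :
    0 < ∫ v : V, Real.exp (-b * ‖v‖ ^ 2) := by
  rw [GaussianFourier.integral_rexp_neg_mul_sq_norm hb]
  positivity

/-- A Hellinger-type argument: write the Gaussians as squares `p ^ 2`, `q ^ 2`. With `t = h * √a`,
the AM-GM inequality bounds `|p - q| * (p + q)` by `|p - q| ^ 2 / t + t / 4 * (p + q) ^ 2`. The
parallelogram law turns `p * q` into a multiple of the Gaussian at the midpoint, so `∫ (p - q) ^ 2`
is explicit and at most `t ^ 2 * I`. -/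
lemma integral_abs_gaussian_sub_le {a : ℝ} (ha : 0 < a) (x y : V) :
    ∫ u, |Real.exp (-(2 * a) * ‖x - u‖ ^ 2) - Real.exp (-(2 * a) * ‖y - u‖ ^ 2)| ≤
      2 * ‖x - y‖ * √a * ∫ u : V, Real.exp (-(2 * a) * ‖u‖ ^ 2) := by
  rcases (norm_nonneg (x - y)).eq_or_lt with h0 | hpos
  · have hxy : x = y := by rwa [eq_comm, norm_eq_zero, sub_eq_zero] at h0
    simp [hxy]
  set h := ‖x - y‖ with hh
  set I := ∫ u : V, Real.exp (-(2 * a) * ‖u‖ ^ 2) with hI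
  have hsa : 0 < √a := Real.sqrt_pos.2 ha
  have hsq : √a * √a = a := Real.mul_self_sqrt ha.le
  have hint : ∀ z : V, Integrable fun u : V => Real.exp (-(2 * a) * ‖z - u‖ ^ 2) := fun z =>
    (integrable_gaussian (V := V) (b := 2 * a) (by positivity)).comp_sub_left z
  have hval : ∀ z : V, ∫ u : V, Real.exp (-(2 * a) * ‖z - u‖ ^ 2) = I := fun z =>
    integral_sub_left_eq_self (fun u : V => Real.exp (-(2 * a) * ‖u‖ ^ 2)) volume z
  set m := (2 : ℝ)⁻¹ • (x + y) with hm
  have hprod : ∀ u : V, Real.exp (-a * ‖x - u‖ ^ 2) * Real.exp (-a * ‖y - u‖ ^ 2) =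
      Real.exp (-(a * h ^ 2 / 2)) * Real.exp (-(2 * a) * ‖m - u‖ ^ 2) := by
    intro u
    rw [← Real.exp_add, ← Real.exp_add]
    congr 1
    have e1 := parallelogram_law_with_norm ℝ (x - u) (y - u)
    have e2 : (x - u) + (y - u) = (2 : ℝ) • (m - u) := by
      rw [hm, smul_sub, smul_smul]
      norm_num
      rw [two_smul]
      abel
    have e3 : (x - u) - (y - u) = x - y := by abel
    rw [e2, e3, norm_smul, ← hh] at e1
    norm_num at e1
    linear_combination (-a / 2) * (-e1)
  have hsqr : ∀ z u : V, Real.exp (-(2 * a) * ‖z - u‖ ^ 2) = Real.exp (-a * ‖z - u‖ ^ 2) ^ 2 := by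
    intro z u
    rw [← Real.exp_nat_mul]
    congr 1
    push_cast
    ring
  have hpt : ∀ u : V,
      |Real.exp (-(2 * a) * ‖x - u‖ ^ 2) - Real.exp (-(2 * a) * ‖y - u‖ ^ 2)| ≤
      (h * √a)⁻¹ * (Real.exp (-(2 * a) * ‖x - u‖ ^ 2) + Real.exp (-(2 * a) * ‖y - u‖ ^ 2)
        - 2 * (Real.exp (-(a * h ^ 2 / 2)) * Real.exp (-(2 * a) * ‖m - u‖ ^ 2))) +
      (h * √a) / 2 * (Real.exp (-(2 * a) * ‖x - u‖ ^ 2) + Real.exp (-(2 * a) * ‖y - u‖ ^ 2)) := by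
    intro u
    rw [← hprod u, hsqr x, hsqr y]
    set p := Real.exp (-a * ‖x - u‖ ^ 2)
    set q := Real.exp (-a * ‖y - u‖ ^ 2)
    have hp : 0 < p := Real.exp_pos _
    have hq : 0 < q := Real.exp_pos _
    set t := h * √a with ht
    have htpos : 0 < t := by positivity
    have e1 : |p ^ 2 - q ^ 2| = |p - q| * (p + q) := by
      rw [sq_sub_sq, abs_mul, abs_of_pos (add_pos hp hq), mul_comm]
    have e2 : t⁻¹ * (p ^ 2 + q ^ 2 - 2 * (p * q)) = t⁻¹ * |p - q| ^ 2 := by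
      rw [sq_abs]; ring
    rw [e1, e2]
    have e3 : t * (t⁻¹ * |p - q| ^ 2 + t / 4 * (p + q) ^ 2 - |p - q| * (p + q)) =
        (|p - q| - t / 2 * (p + q)) ^ 2 := by
      field_simp
      ring
    have e4 : 0 ≤ t⁻¹ * |p - q| ^ 2 + t / 4 * (p + q) ^ 2 - |p - q| * (p + q) :=
      nonneg_of_mul_nonneg_right (e3 ▸ sq_nonneg _) htpos
    nlinarith [mul_nonneg htpos.le (sq_nonneg (p - q))]
  have hint1 : Integrable fun u : V =>
      Real.exp (-(2 * a) * ‖x - u‖ ^ 2) + Real.exp (-(2 * a) * ‖y - u‖ ^ 2) :=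
    (hint x).add (hint y)
  have hint2 : Integrable fun u : V =>
      2 * (Real.exp (-(a * h ^ 2 / 2)) * Real.exp (-(2 * a) * ‖m - u‖ ^ 2)) :=
    ((hint m).const_mul _).const_mul _
  have hint3 : Integrable fun u : V => (h * √a)⁻¹ *
      (Real.exp (-(2 * a) * ‖x - u‖ ^ 2) + Real.exp (-(2 * a) * ‖y - u‖ ^ 2)
        - 2 * (Real.exp (-(a * h ^ 2 / 2)) * Real.exp (-(2 * a) * ‖m - u‖ ^ 2))) :=
    (hint1.sub hint2).const_mul _
  refine (integral_mono ((hint x).sub (hint y)).abs (hint3.add (hint1.const_mul _)) hpt).trans ?_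
  have hIpos : 0 < I := integral_gaussian_pos (by positivity)
  have hexp : 1 - Real.exp (-(a * h ^ 2 / 2)) ≤ a * h ^ 2 / 2 := by
    linarith [Real.add_one_le_exp (-(a * h ^ 2 / 2))]
  calc _ = (h * √a)⁻¹ * (I + I - 2 * (Real.exp (-(a * h ^ 2 / 2)) * I)) +
        (h * √a) / 2 * (I + I) := by
        simp only [Pi.add_apply]
        rw [integral_add hint3 (hint1.const_mul _),
          integral_const_mul, integral_const_mul, integral_sub hint1 hint2, integral_add (hint x) (hint y), integral_const_mul,
          integral_const_mul, hval, hval, hval]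
    _ = (h * √a)⁻¹ * (2 * (1 - Real.exp (-(a * h ^ 2 / 2)))) * I + h * √a * I := by ring
    _ ≤ (h * √a)⁻¹ * (2 * (a * h ^ 2 / 2)) * I + h * √a * I := by gcongr
    _ = 2 * h * √a * I := by
        have : (h * √a)⁻¹ * (2 * (a * h ^ 2 / 2)) = h * √a := by
          rw [inv_mul_eq_iff_eq_mul₀ (by positivity)]
          linear_combination (-h ^ 2) * hsq
        rw [this]; ring

/-- The sets are hypographs of translates of `g`, a Gaussian cut off at radius `Δ / 2`. The bounded
support controls diameters, and symmetric differences become `L¹` distances between translates. -/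
theorem decomposable_euclidean {ι : Type*} [Finite ι] (f : ι → V) {d : ℕ} (hd : 1 ≤ d)
    (hV : Module.finrank ℝ V = d) {Δ : ℝ} (hΔ : 0 < Δ) :
    Decomposable (fun x y => ‖f x - f y‖ ≤ Δ)
      (fun x y => ENNReal.ofReal (64 * √d * ‖f x - f y‖ / Δ)) := by
  set r := Δ / 2 with hr
  have hr0 : 0 < r := by positivity
  have hd0 : (1 : ℝ) ≤ d := by exact_mod_cast hd
  -- Chosen so that `a * (r / 2) ^ 2 = 2 * d`: the Gaussian mass outside radius `r / 2` is at most
  -- `exp (-2d) * 2 ^ (d / 2)` times the total, so the cutoff loses at most half.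
  set a := 8 * d / r ^ 2 with ha
  have ha0 : 0 < a := by positivity
  set I := ∫ u : V, Real.exp (-(2 * a) * ‖u‖ ^ 2) with hI
  have hI0 : 0 < I := integral_gaussian_pos (by positivity)
  let g : V → ℝ := fun v => Real.exp (-(2 * a) * ‖v‖ ^ 2) * cutoff r v
  have hχ0 : ∀ v : V, 0 ≤ cutoff r v := fun v => le_max_left _ _
  have hχ1 : ∀ v : V, cutoff r v ≤ 1 := fun v => max_le zero_le_one (min_le_left _ _)
  have hg0 : ∀ v, 0 ≤ g v := fun v => mul_nonneg (Real.exp_pos _).le (hχ0 v)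
  have hgle : ∀ v, g v ≤ Real.exp (-(2 * a) * ‖v‖ ^ 2) := fun v =>
    mul_le_of_le_one_right (Real.exp_pos _).le (hχ1 v)
  have hgc : Continuous g := by
    simp only [g, cutoff]
    fun_prop
  have hintG : Integrable fun v : V => Real.exp (-(2 * a) * ‖v‖ ^ 2) :=
    integrable_gaussian (by positivity)
  have hintg : Integrable g := by
    refine hintG.mono' hgc.aestronglyMeasurable (Filter.Eventually.of_forall fun v => ?_)
    rw [Real.norm_of_nonneg (hg0 v)]
    exact hgle v
  have hsupp : ∀ v, 0 < g v → ‖v‖ < r := by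
    intro v hv
    by_contra! h
    have h2 : 2 - 2 * ‖v‖ / r ≤ 0 := by
      rw [sub_nonpos, le_div_iff₀ hr0]; linarith
    have : cutoff r v = 0 := max_eq_left ((min_le_right _ _).trans h2)
    simp [g, this] at hv
  have hlow : I / 2 ≤ ∫ v, g v := by
    have hintF : Integrable fun v : V => Real.exp (-a * ‖v‖ ^ 2) := integrable_gaussian ha0
    have hpt : ∀ v : V, Real.exp (-(2 * a) * ‖v‖ ^ 2) -
        Real.exp (-(2 * d)) * Real.exp (-a * ‖v‖ ^ 2) ≤ g v := by
      intro v
      by_cases hv : ‖v‖ ≤ r / 2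
      · have h2 : 1 ≤ 2 - 2 * ‖v‖ / r := by
          rw [le_sub_comm, div_le_iff₀ hr0]; linarith
        have : cutoff r v = 1 := by
          rw [cutoff, min_eq_left h2, max_eq_right zero_le_one]
        simp only [g, this, mul_one]
        have := Real.exp_pos (-(2 * d : ℝ))
        have := Real.exp_pos (-a * ‖v‖ ^ 2)
        nlinarith
      · refine le_trans ?_ (hg0 v)
        rw [sub_nonpos, ← Real.exp_add]
        refine Real.exp_le_exp.2 ?_
        push Not at hv
        have h3 : 2 * (d : ℝ) = a * (r / 2) ^ 2 := by rw [ha]; field_simp; ring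
        have h4 : (r / 2) ^ 2 ≤ ‖v‖ ^ 2 := by gcongr
        nlinarith
    have hF : ∫ v : V, Real.exp (-a * ‖v‖ ^ 2) = 2 ^ (d / 2 : ℝ) * I := by
      rw [hI, GaussianFourier.integral_rexp_neg_mul_sq_norm ha0,
        GaussianFourier.integral_rexp_neg_mul_sq_norm (by positivity : 0 < 2 * a), hV,
        ← Real.mul_rpow (by positivity) (by positivity)]
      congr 1
      field_simp
    have hsmall : Real.exp (-(2 * d)) * 2 ^ (d / 2 : ℝ) ≤ 1 / 2 := by
      have h2 : (2 : ℝ) ≤ Real.exp 1 := by linarith [Real.add_one_le_exp (1 : ℝ)]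
      have h2' : (2 : ℝ) ^ (d / 2 : ℝ) ≤ Real.exp d := by
        calc (2 : ℝ) ^ (d / 2 : ℝ) ≤ 2 ^ (d : ℝ) :=
              Real.rpow_le_rpow_of_exponent_le one_le_two (by linarith)
          _ ≤ (Real.exp 1) ^ (d : ℝ) := by gcongr
          _ = Real.exp d := by rw [← Real.exp_mul, one_mul]
      calc Real.exp (-(2 * d)) * 2 ^ (d / 2 : ℝ) ≤ Real.exp (-(2 * d)) * Real.exp d := by gcongr
        _ = Real.exp (-d) := by rw [← Real.exp_add]; congr 1; ring
        _ ≤ Real.exp (-1) := Real.exp_le_exp.2 (by linarith)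
        _ ≤ 1 / 2 := by
          rw [Real.exp_neg, ← one_div]
          exact one_div_le_one_div_of_le two_pos h2
    calc I / 2 ≤ I - Real.exp (-(2 * d)) * (2 ^ (d / 2 : ℝ) * I) := by nlinarith
      _ = ∫ v : V, (Real.exp (-(2 * a) * ‖v‖ ^ 2) -
          Real.exp (-(2 * d)) * Real.exp (-a * ‖v‖ ^ 2)) := by
          rw [integral_sub hintG (hintF.const_mul _), integral_const_mul, hF]
      _ ≤ _ := integral_mono (hintG.sub (hintF.const_mul _)) hintg hpt
  let B : ι → Set (V × ℝ) := fun x => {z | 0 < z.2 ∧ z.2 < g (f x - z.1)}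
  have hgm : ∀ x, Measurable fun u => g (f x - u) := fun x =>
    (hgc.comp (continuous_const.sub continuous_id)).measurable
  have hintgx : ∀ x, Integrable fun u => g (f x - u) := fun x => hintg.comp_sub_left (f x)
  have hBval : ∀ x, (volume.prod volume : Measure (V × ℝ)) (B x) = ENNReal.ofReal (∫ v, g v) := by
    intro x
    rw [measure_prod_hypograph volume (hgm x),
      ← ofReal_integral_eq_lintegral_ofReal (hintgx x) (Filter.Eventually.of_forall fun u => hg0 _),
      integral_sub_left_eq_self g volume (f x)]
  have hgpos : 0 < ∫ v, g v := by linarith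
  have hdiff : ∀ x y, (volume.prod volume : Measure (V × ℝ)) (B x \ B y) ≤
      ENNReal.ofReal (2 * ‖f x - f y‖ * √a * I + 2 * ‖f x - f y‖ / r * I) := by
    intro x y
    refine (measure_prod_sdiff_hypograph_le volume (hgm x) (hgm y)).trans ?_
    have hintd : Integrable fun u => |g (f x - u) - g (f y - u)| :=
      ((hintgx x).sub (hintgx y)).abs
    rw [← ofReal_integral_eq_lintegral_ofReal hintd
      (Filter.Eventually.of_forall fun u => abs_nonneg _)]
    refine ENNReal.ofReal_le_ofReal ?_
    have hix : Integrable fun u : V => Real.exp (-(2 * a) * ‖f x - u‖ ^ 2) :=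
      hintG.comp_sub_left (f x)
    have hiy : Integrable fun u : V => Real.exp (-(2 * a) * ‖f y - u‖ ^ 2) :=
      hintG.comp_sub_left (f y)
    have hpt : ∀ u : V, |g (f x - u) - g (f y - u)| ≤
        |Real.exp (-(2 * a) * ‖f x - u‖ ^ 2) - Real.exp (-(2 * a) * ‖f y - u‖ ^ 2)| +
        2 * ‖f x - f y‖ / r * Real.exp (-(2 * a) * ‖f y - u‖ ^ 2) := by
      intro u
      simp only [g]
      set p := Real.exp (-(2 * a) * ‖f x - u‖ ^ 2)
      set q := Real.exp (-(2 * a) * ‖f y - u‖ ^ 2)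
      have hq : 0 < q := Real.exp_pos _
      have hc := abs_cutoff_sub_le hr0 (f x - u) (f y - u)
      rw [sub_sub_sub_cancel_right] at hc
      calc |p * cutoff r (f x - u) - q * cutoff r (f y - u)|
          = |(p - q) * cutoff r (f x - u) + q * (cutoff r (f x - u) - cutoff r (f y - u))| := by
            congr 1; ring
        _ ≤ |p - q| * |cutoff r (f x - u)| + q * |cutoff r (f x - u) - cutoff r (f y - u)| := by
            refine (abs_add_le _ _).trans ?_
            rw [abs_mul, abs_mul, abs_of_pos hq]
        _ ≤ |p - q| * 1 + q * (2 * ‖f x - f y‖ / r) := by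
            gcongr
            rw [abs_of_nonneg (hχ0 _)]
            exact hχ1 _
        _ = _ := by ring
    have hixy : Integrable fun u : V =>
        |Real.exp (-(2 * a) * ‖f x - u‖ ^ 2) - Real.exp (-(2 * a) * ‖f y - u‖ ^ 2)| :=
      (hix.sub hiy).abs
    refine (integral_mono hintd (hixy.add (hiy.const_mul _)) hpt).trans ?_
    simp only [Pi.add_apply]
    rw [integral_add hixy (hiy.const_mul _), integral_const_mul,
      integral_sub_left_eq_self (fun u : V => Real.exp (-(2 * a) * ‖u‖ ^ 2)) volume (f y)]
    gcongr
    exact integral_abs_gaussian_sub_le ha0 (f x) (f y)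
  refine decomposable_of_measure (volume.prod volume : Measure (V × ℝ)) B ?_ ?_ ?_ ?_ ?_
  · intro x
    exact (measurableSet_lt measurable_const measurable_snd).inter
      (measurableSet_lt measurable_snd ((hgm x).comp measurable_fst))
  · intro x
    rw [hBval]
    simpa using hgpos
  · intro x
    rw [hBval]
    exact ENNReal.ofReal_ne_top
  · rintro ⟨u, τ⟩ x y ⟨h1, h2⟩ ⟨_, h4⟩
    have hx := hsupp _ (h1.trans h2)
    have hy := hsupp _ (h1.trans h4)
    calc ‖f x - f y‖ = ‖(f x - u) - (f y - u)‖ := by rw [sub_sub_sub_cancel_right]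
      _ ≤ ‖f x - u‖ + ‖f y - u‖ := norm_sub_le _ _
      _ ≤ Δ := by simp only at hx hy; linarith
  · intro x y
    refine (add_le_add (hdiff x y) (hdiff y x)).trans ?_
    rw [hBval, norm_sub_rev (f y) (f x), ← ENNReal.ofReal_add (by positivity) (by positivity),
      ← ENNReal.ofReal_mul (by positivity)]
    refine ENNReal.ofReal_le_ofReal ?_
    refine le_trans ?_ (mul_le_mul_of_nonneg_left hlow (by positivity))
    have hsa : √a ≤ 3 * √d / r := by
      rw [Real.sqrt_le_left (by positivity), ha, div_pow (3 * √d), mul_pow, Real.sq_sqrt (by positivity)]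
      gcongr
      norm_num
    have hsd : 1 ≤ √d := Real.one_le_sqrt.2 hd0
    set h := ‖f x - f y‖
    have hh : 0 ≤ h := norm_nonneg _
    have hΔr : Δ = 2 * r := by rw [hr]; ring
    calc 2 * h * √a * I + 2 * h / r * I + (2 * h * √a * I + 2 * h / r * I)
        = h * I * (4 * √a + 4 * 1 / r) := by ring
      _ ≤ h * I * (4 * (3 * √d / r) + 4 * √d / r) := by gcongr
      _ = 64 * √d * h / Δ * (I / 2) := by rw [hΔr]; field_simp; ring

end Euclidean

/-! ### Dimension reduction: the bound in terms of `log n`. -/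

section RandomSigns

lemma decomposable_of_average {ι Ω : Type*} {close : ι → ι → Prop} (s : Finset Ω)
    (hs : s.Nonempty) (sep : Ω → ι → ι → ℝ) (t : ι → ι → ℝ)
    (hsep : ∀ ω x y, 0 ≤ sep ω x y)
    (h : ∀ ω ∈ s, Decomposable close fun x y => ENNReal.ofReal (sep ω x y))
    (hsum : ∀ x y, ∑ ω ∈ s, sep ω x y ≤ s.card * t x y) :
    Decomposable close fun x y => ENNReal.ofReal (t x y) := by
  classical
  have h' : ∀ ω, ∃ D : PMF (Setoid ι), ω ∈ s → (∀ P ∈ D.support, ∀ x y, P x y → close x y) ∧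
      ∀ x y, D.toOuterMeasure {P | ¬ P x y} ≤ ENNReal.ofReal (sep ω x y) := by
    intro ω
    by_cases hω : ω ∈ s
    · obtain ⟨D, hD⟩ := h ω hω
      exact ⟨D, fun _ => hD⟩
    · exact ⟨PMF.pure ⊤, fun h => absurd h hω⟩
  choose F hF using h'
  have hcard : (s.card : ℝ≥0∞) ≠ 0 := by simpa using hs.ne_empty
  refine ⟨(PMF.uniformOfFinset s hs).bind F, ?_, ?_⟩
  · intro P hP
    rw [PMF.mem_support_bind_iff] at hP
    obtain ⟨ω, hω, hP⟩ := hP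
    exact (hF ω ((PMF.mem_support_uniformOfFinset_iff hs ω).1 hω)).1 P hP
  · intro x y
    rw [PMF.toOuterMeasure_bind_apply]
    calc ∑' ω, (PMF.uniformOfFinset s hs) ω * (F ω).toOuterMeasure {P | ¬ P x y}
        = ∑ ω ∈ s, (PMF.uniformOfFinset s hs) ω * (F ω).toOuterMeasure {P | ¬ P x y} := by
          refine tsum_eq_sum fun ω hω => ?_
          rw [PMF.uniformOfFinset_apply_of_notMem hs hω, zero_mul]
      _ ≤ ∑ ω ∈ s, (s.card : ℝ≥0∞)⁻¹ * ENNReal.ofReal (sep ω x y) := by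
          refine Finset.sum_le_sum fun ω hω => ?_
          rw [PMF.uniformOfFinset_apply_of_mem hs hω]
          gcongr
          exact (hF ω hω).2 x y
      _ = (s.card : ℝ≥0∞)⁻¹ * ENNReal.ofReal (∑ ω ∈ s, sep ω x y) := by
          rw [← Finset.mul_sum, ENNReal.ofReal_sum_of_nonneg fun ω _ => hsep ω x y]
      _ ≤ (s.card : ℝ≥0∞)⁻¹ * ENNReal.ofReal (s.card * t x y) := by
          gcongr
          exact hsum x y
      _ = ENNReal.ofReal (t x y) := by
          rw [ENNReal.ofReal_mul (Nat.cast_nonneg _), ENNReal.ofReal_natCast, ← mul_assoc,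
            ENNReal.inv_mul_cancel hcard (ENNReal.natCast_ne_top _), one_mul]

/-- The signed sum `∑ ± z j`, the signs being given by `ε`. -/
def signSum {d : ℕ} (ε : Fin d → Bool) (z : Fin d → ℝ) : ℝ :=
  ∑ j, (if ε j then 1 else -1) * z j

lemma sum_signs_succ {d : ℕ} (z : Fin (d + 1) → ℝ) (F : ℝ → ℝ) :
    ∑ ε : Fin (d + 1) → Bool, F (signSum ε z) =
      ∑ ε : Fin d → Bool, (F (z 0 + signSum ε (fun j => z j.succ)) +
        F (-z 0 + signSum ε (fun j => z j.succ))) := by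
  rw [← (Fin.consEquiv fun _ : Fin (d + 1) => Bool).sum_comp, Fintype.sum_prod_type_right]
  refine Finset.sum_congr rfl fun ε _ => ?_
  simp [signSum, Fin.sum_univ_succ, Fin.consEquiv]

lemma sum_signSum_sq {d : ℕ} (z : Fin d → ℝ) :
    ∑ ε : Fin d → Bool, signSum ε z ^ 2 = 2 ^ d * ∑ j, z j ^ 2 := by
  induction d with
  | zero => simp [signSum]
  | succ d ih =>
    rw [sum_signs_succ z (fun t => t ^ 2), Fin.sum_univ_succ]
    calc _ = ∑ ε : Fin d → Bool, (2 * z 0 ^ 2 + 2 * signSum ε (fun j => z j.succ) ^ 2) :=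
          Finset.sum_congr rfl fun ε _ => by ring
      _ = _ := by
          rw [Finset.sum_add_distrib, ← Finset.mul_sum, ← Finset.mul_sum, ih]
          simp
          ring

lemma sum_signSum_pow_four_le {d : ℕ} (z : Fin d → ℝ) :
    ∑ ε : Fin d → Bool, signSum ε z ^ 4 ≤ 2 ^ d * (3 * (∑ j, z j ^ 2) ^ 2) := by
  induction d with
  | zero => simp [signSum]
  | succ d ih =>
    rw [sum_signs_succ z (fun t => t ^ 4), Fin.sum_univ_succ]
    have h2 := sum_signSum_sq (fun j : Fin d => z j.succ)
    have h4 := ih (fun j : Fin d => z j.succ)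
    set s := ∑ j : Fin d, z j.succ ^ 2
    calc _ = ∑ ε : Fin d → Bool, (2 * z 0 ^ 4 + (12 * z 0 ^ 2 * signSum ε (fun j => z j.succ) ^ 2
            + 2 * signSum ε (fun j => z j.succ) ^ 4)) :=
          Finset.sum_congr rfl fun ε _ => by ring
      _ = 2 ^ d * (2 * z 0 ^ 4) + (12 * z 0 ^ 2 * (2 ^ d * s) +
            2 * ∑ ε : Fin d → Bool, signSum ε (fun j => z j.succ) ^ 4) := by
          rw [Finset.sum_add_distrib, Finset.sum_add_distrib, ← Finset.mul_sum, ← Finset.mul_sum,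
            ← Finset.mul_sum, h2]
          simp
          ring
      _ ≤ 2 ^ d * (2 * z 0 ^ 4) + (12 * z 0 ^ 2 * (2 ^ d * s) + 2 * (2 ^ d * (3 * s ^ 2))) := by
          gcongr
      _ = 2 ^ (d + 1) * (z 0 ^ 4 + 6 * z 0 ^ 2 * s + 3 * s ^ 2) := by ring
      _ ≤ 2 ^ (d + 1) * (3 * (z 0 ^ 2 + s) ^ 2) := by
          gcongr
          nlinarith [sq_nonneg (z 0 ^ 2)]

/-- Multiply by `exp t ≥ 1 + t + t ^ 2 / 2`; the product of the two quadratics is `1 + t ^ 4 / 4`.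
-/
lemma exp_neg_le_quadratic {t : ℝ} (ht : 0 ≤ t) : Real.exp (-t) ≤ 1 - t + t ^ 2 / 2 := by
  have h1 := Real.quadratic_le_exp_of_nonneg ht
  have h2 : (1 - t + t ^ 2 / 2) * (1 + t + t ^ 2 / 2) = 1 + t ^ 4 / 4 := by ring
  have h3 : 0 ≤ 1 - t + t ^ 2 / 2 := by nlinarith [sq_nonneg (t - 1)]
  rw [Real.exp_neg, inv_le_iff_one_le_mul₀ (Real.exp_pos t)]
  nlinarith [mul_le_mul_of_nonneg_left h1 h3, pow_nonneg ht 4]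

/-- Insert the second and fourth moments into the quadratic bound. The scale `3 * s` is optimal: `1
- c + 3 * c ^ 2 / 2` is smallest at `c = 1 / 3`, with value `5 / 6`. -/
lemma sum_exp_neg_signSum_le {d : ℕ} (z : Fin d → ℝ) {s : ℝ} (hs : ∑ j, z j ^ 2 = s)
    (h0 : 0 < s) :
    ∑ ε : Fin d → Bool, Real.exp (-(signSum ε z ^ 2 / (3 * s))) ≤ 2 ^ d * (5 / 6) := by
  have h2 := sum_signSum_sq z
  have h4 := sum_signSum_pow_four_le z
  rw [hs] at h2 h4
  calc _ ≤ ∑ ε : Fin d → Bool, (1 - signSum ε z ^ 2 / (3 * s) +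
        (signSum ε z ^ 2 / (3 * s)) ^ 2 / 2) :=
        Finset.sum_le_sum fun ε _ => exp_neg_le_quadratic (by positivity)
    _ = ∑ ε : Fin d → Bool, (1 - (3 * s)⁻¹ * signSum ε z ^ 2 +
        (18 * s ^ 2)⁻¹ * signSum ε z ^ 4) :=
        Finset.sum_congr rfl fun ε _ => by field_simp; ring
    _ = 2 ^ d - (3 * s)⁻¹ * (2 ^ d * s) +
        (18 * s ^ 2)⁻¹ * ∑ ε : Fin d → Bool, signSum ε z ^ 4 := by
        rw [Finset.sum_add_distrib, Finset.sum_sub_distrib, ← Finset.mul_sum, ← Finset.mul_sum, h2]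
        simp
    _ ≤ 2 ^ d - (3 * s)⁻¹ * (2 ^ d * s) + (18 * s ^ 2)⁻¹ * (2 ^ d * (3 * s ^ 2)) := by gcongr
    _ = 2 ^ d * (5 / 6) := by field_simp; ring

/-- Chernoff bound for the lower tail: the rows are independent, so the exponential moment is at
most `(5 / 6) ^ k`, and `1 / 6 = 1 / 10 + 1 / 15`. No upper tail is needed, since expansion is
controlled on average. -/
lemma card_signMatrix_shrink_le {d : ℕ} (k : ℕ) (z : Fin d → ℝ) :
    ((Finset.univ.filter fun ω : Fin k → Fin d → Bool =>
      ∑ i, signSum (ω i) z ^ 2 < k / 5 * ∑ j, z j ^ 2).card : ℝ) ≤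
      (2 ^ d) ^ k * Real.exp (-(k / 10)) := by
  set s := ∑ j, z j ^ 2 with hs
  have hs0 : 0 ≤ s := Finset.sum_nonneg fun j _ => sq_nonneg _
  rcases hs0.eq_or_lt with h0 | h0
  · rw [← h0, mul_zero, Finset.filter_false_of_mem]
    · simp only [Finset.card_empty, Nat.cast_zero]; positivity
    · intro ω _
      exact not_lt.2 (Finset.sum_nonneg fun j _ => sq_nonneg _)
  set bad := Finset.univ.filter fun ω : Fin k → Fin d → Bool =>
      ∑ i, signSum (ω i) z ^ 2 < k / 5 * s with hbad
  have h1 : (bad.card : ℝ) * Real.exp (-(k / 15)) ≤ (2 ^ d * (5 / 6)) ^ k := by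
    calc (bad.card : ℝ) * Real.exp (-(k / 15))
        = ∑ ω ∈ bad, Real.exp (-(k / 15)) := by rw [Finset.sum_const, nsmul_eq_mul]
      _ ≤ ∑ ω ∈ bad, ∏ i, Real.exp (-(signSum (ω i) z ^ 2 / (3 * s))) := by
          refine Finset.sum_le_sum fun ω hω => ?_
          rw [← Real.exp_sum, Real.exp_le_exp, Finset.sum_neg_distrib, neg_le_neg_iff,
            ← Finset.sum_div, div_le_iff₀ (by positivity)]
          have := (Finset.mem_filter.1 hω).2
          linarith
      _ ≤ ∑ ω : Fin k → Fin d → Bool, ∏ i, Real.exp (-(signSum (ω i) z ^ 2 / (3 * s))) :=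
          Finset.sum_le_sum_of_subset_of_nonneg (Finset.subset_univ _) fun ω _ _ =>
            Finset.prod_nonneg fun i _ => (Real.exp_pos _).le
      _ = (∑ ε : Fin d → Bool, Real.exp (-(signSum ε z ^ 2 / (3 * s)))) ^ k :=
          (Fintype.sum_pow (fun ε : Fin d → Bool => Real.exp (-(signSum ε z ^ 2 / (3 * s)))) k).symm
      _ ≤ _ := by
          gcongr
          exact sum_exp_neg_signSum_le z hs.symm h0
  have h2 : (5 / 6 : ℝ) ^ k ≤ Real.exp (-(k / 10)) * Real.exp (-(k / 15)) := by
    have : (5 / 6 : ℝ) ≤ Real.exp (-(1 / 6)) := by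
      linarith [Real.add_one_le_exp (-(1 / 6) : ℝ)]
    calc (5 / 6 : ℝ) ^ k ≤ Real.exp (-(1 / 6)) ^ k := by gcongr
      _ = _ := by rw [← Real.exp_nat_mul, ← Real.exp_add]; congr 1; ring
  rw [mul_pow] at h1
  refine le_of_mul_le_mul_right (h1.trans ?_) (Real.exp_pos (-(k / 15 : ℝ)))
  rw [mul_assoc]
  gcongr

lemma sum_signMatrix_sq {d : ℕ} (k : ℕ) (z : Fin d → ℝ) :
    ∑ ω : Fin k → Fin d → Bool, ∑ i, signSum (ω i) z ^ 2 = (2 ^ d) ^ k * (k * ∑ j, z j ^ 2) := by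
  rw [Finset.sum_comm]
  have : ∀ i : Fin k, ∑ ω : Fin k → Fin d → Bool, signSum (ω i) z ^ 2 =
      (2 ^ d) ^ k * ∑ j, z j ^ 2 := by
    intro i
    have h := Fintype.sum_piFinset_apply (fun ε : Fin d → Bool => signSum ε z ^ 2) Finset.univ i
    rw [Fintype.piFinset_univ, sum_signSum_sq] at h
    rw [h]
    have hk : 0 < k := i.pos
    obtain ⟨m, rfl⟩ : ∃ m, k = m + 1 := ⟨k - 1, by omega⟩
    simp
    ring
  rw [Finset.sum_congr rfl fun i _ => this i]
  simp
  ring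

/-- The linear map given by a sign matrix. -/
def signMap {d k : ℕ} (ω : Fin k → Fin d → Bool) (z : EuclideanSpace ℝ (Fin d)) :
    EuclideanSpace ℝ (Fin k) := WithLp.toLp 2 fun i => signSum (ω i) z

lemma signMap_sub {d k : ℕ} (ω : Fin k → Fin d → Bool) (z w : EuclideanSpace ℝ (Fin d)) :
    signMap ω z - signMap ω w = signMap ω (z - w) := by
  ext i
  simp [signMap, signSum, mul_sub]

lemma norm_signMap_sq {d k : ℕ} (ω : Fin k → Fin d → Bool) (z : EuclideanSpace ℝ (Fin d)) :
    ‖signMap ω z‖ ^ 2 = ∑ i, signSum (ω i) z ^ 2 := by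
  rw [EuclideanSpace.real_norm_sq_eq]
  rfl

lemma sum_norm_signMap_le {d k : ℕ} (z : EuclideanSpace ℝ (Fin d)) :
    ∑ ω : Fin k → Fin d → Bool, ‖signMap ω z‖ ≤ (2 ^ d) ^ k * (√k * ‖z‖) := by
  refine le_of_sq_le_sq ?_ (by positivity)
  refine (sq_sum_le_card_mul_sum_sq (s := Finset.univ)).trans ?_
  simp only [norm_signMap_sq]
  rw [sum_signMatrix_sq, ← EuclideanSpace.real_norm_sq_eq, mul_pow _ (√k * ‖z‖), mul_pow √k,
    Real.sq_sqrt (Nat.cast_nonneg k)]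
  simp
  apply le_of_eq
  ring

/-- Dimension reduction by random signs. -/
theorem decomposable_euclidean_log {ι : Type*} [Fintype ι] {n d : ℕ} (hn : 2 ≤ n)
    (hι : Fintype.card ι ≤ n) (f : ι → EuclideanSpace ℝ (Fin d)) {Δ : ℝ} (hΔ : 0 < Δ) :
    Decomposable (fun x y => ‖f x - f y‖ ≤ Δ)
      (fun x y => ENNReal.ofReal (2048 * √(Real.log n) * ‖f x - f y‖ / Δ)) := by
  classical
  have hn0 : (2 : ℝ) ≤ n := by exact_mod_cast hn
  have hlog : 1 / 2 ≤ Real.log n := by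
    have : Real.log 2 ≤ Real.log n := Real.log_le_log two_pos hn0
    linarith [Real.log_two_gt_d9]
  -- Then `exp (-k / 10) ≤ n ^ (-3)`, which survives a union bound over at most `n ^ 2` pairs.
  set k := ⌈30 * Real.log n⌉₊ with hk
  have hk1 : 30 * Real.log n ≤ k := Nat.le_ceil _
  have hk2 : (k : ℝ) ≤ 32 * Real.log n := by
    have := (Nat.ceil_lt_add_one (show 0 ≤ 30 * Real.log n by linarith)).le
    linarith
  have hk0 : (0 : ℝ) < k := by linarith
  have hkpos : 1 ≤ k := by exact_mod_cast hk0
  let bad : ι × ι → Finset (Fin k → Fin d → Bool) := fun q => Finset.univ.filter fun ω =>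
    ∑ i, signSum (ω i) (f q.1 - f q.2) ^ 2 < k / 5 * ∑ j, (f q.1 - f q.2) j ^ 2
  let allBad : Finset (Fin k → Fin d → Bool) := Finset.univ.biUnion bad
  let good : Finset (Fin k → Fin d → Bool) := Finset.univ \ allBad
  set M : ℝ := (2 ^ d) ^ k with hM
  have hM0 : 0 < M := by positivity
  have hallBad : (allBad.card : ℝ) ≤ M / 2 := by
    have hexp : Real.exp (-(k / 10)) ≤ ((n : ℝ) ^ 3)⁻¹ := by
      rw [← Real.exp_log (show (0 : ℝ) < ((n : ℝ) ^ 3)⁻¹ by positivity), Real.exp_le_exp,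
        Real.log_inv, Real.log_pow]
      push_cast
      linarith
    calc (allBad.card : ℝ) ≤ ∑ q : ι × ι, ((bad q).card : ℝ) := by
          exact_mod_cast Finset.card_biUnion_le
      _ ≤ ∑ q : ι × ι, M * Real.exp (-(k / 10)) :=
          Finset.sum_le_sum fun q _ => card_signMatrix_shrink_le k _
      _ = (Fintype.card ι * Fintype.card ι) * (M * Real.exp (-(k / 10))) := by
          rw [Finset.sum_const, nsmul_eq_mul, Finset.card_univ, Fintype.card_prod]
          push_cast
          rfl
      _ ≤ (n * n) * (M * ((n : ℝ) ^ 3)⁻¹) := by gcongr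
      _ = M / n := by field_simp
      _ ≤ M / 2 := by gcongr
  have hgood : M / 2 ≤ good.card := by
    have h1 : good.card + allBad.card = (2 ^ d) ^ k := by
      rw [Finset.card_sdiff_add_card_eq_card (Finset.subset_univ _)]
      simp
    have h2 : (good.card : ℝ) + allBad.card = M := by rw [hM]; exact_mod_cast h1
    linarith
  have hgood0 : good.Nonempty := by
    rw [← Finset.card_pos]
    have : (0 : ℝ) < good.card := by linarith
    exact_mod_cast this
  -- A good matrix shrinks no pair by more than the factor `√(k / 5)`, so image diameter `δ` pulls
  -- back to diameter `Δ`.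
  set δ := √(k / 5) * Δ with hδ
  have hδ0 : 0 < δ := by positivity
  refine decomposable_of_average good hgood0
    (fun ω x y => 64 * √k * ‖signMap ω (f x) - signMap ω (f y)‖ / δ) _
    (fun ω x y => by positivity) ?_ ?_
  · intro ω hω
    refine (decomposable_euclidean (fun x => signMap ω (f x)) hkpos (by simp) hδ0).mono ?_
      fun x y => le_rfl
    intro x y hxy
    have hω' : k / 5 * ‖f x - f y‖ ^ 2 ≤ ‖signMap ω (f x - f y)‖ ^ 2 := by
      have h1 : ω ∉ bad (x, y) := fun h =>
        (Finset.mem_sdiff.1 hω).2 (Finset.mem_biUnion.2 ⟨(x, y), Finset.mem_univ _, h⟩)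
      rw [norm_signMap_sq, EuclideanSpace.real_norm_sq_eq]
      simpa [bad] using h1
    rw [signMap_sub] at hxy
    have h3 : √(k / 5) * ‖f x - f y‖ ≤ √(k / 5) * Δ := by
      refine le_trans ?_ hxy
      refine le_of_sq_le_sq ?_ (norm_nonneg _)
      rwa [mul_pow, Real.sq_sqrt (by positivity)]
    exact le_of_mul_le_mul_left h3 (by positivity)
  · intro x y
    simp only [signMap_sub]
    have hsk : √(k : ℝ) ≤ 6 * √(Real.log n) := by
      rw [Real.sqrt_le_left (by positivity), mul_pow, Real.sq_sqrt (by linarith)]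
      linarith
    have h5 : √(k / 5) = √k / √5 := Real.sqrt_div' _ (by norm_num)
    have hs5 : √(5 : ℝ) ≤ 5 / 2 := by
      rw [Real.sqrt_le_left (by norm_num)]; norm_num
    have hs50 : 0 < √(5 : ℝ) := by positivity
    have hsk0 : 0 < √(k : ℝ) := by positivity
    set z := f x - f y
    calc ∑ ω ∈ good, 64 * √k * ‖signMap ω z‖ / δ
        = 64 * √k / δ * ∑ ω ∈ good, ‖signMap ω z‖ := by
          rw [Finset.mul_sum]
          exact Finset.sum_congr rfl fun ω _ => by ring
      _ ≤ 64 * √k / δ * ∑ ω : Fin k → Fin d → Bool, ‖signMap ω z‖ := by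
          gcongr
          exact Finset.subset_univ _
      _ ≤ 64 * √k / δ * (M * (√k * ‖z‖)) := by
          gcongr
          exact sum_norm_signMap_le z
      _ = M / 2 * (128 * √k * √5 * ‖z‖ / Δ) := by
          rw [hδ, h5]; field_simp; ring
      _ ≤ M / 2 * (128 * (6 * √(Real.log n)) * (5 / 2) * ‖z‖ / Δ) := by gcongr
      -- Good matrices make up at least half of all, so averaging over them instead costs a factor
      -- two.
      _ ≤ good.card * (128 * (6 * √(Real.log n)) * (5 / 2) * ‖z‖ / Δ) := by gcongr
      _ ≤ good.card * (2048 * √(Real.log n) * ‖z‖ / Δ) := by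
          have : 128 * (6 * √(Real.log n)) * (5 / 2) ≤ 2048 * √(Real.log n) := by
            linarith [Real.sqrt_nonneg (Real.log n)]
          gcongr

end RandomSigns

/-! ### The scalar Mazur map. -/

section Mazur

/-- The scalar Mazur map `a ↦ sign a * |a| ^ s`. -/
noncomputable def mazur (s a : ℝ) : ℝ := if 0 ≤ a then a ^ s else -(-a) ^ s

lemma mazur_of_nonneg (s : ℝ) {a : ℝ} (ha : 0 ≤ a) : mazur s a = a ^ s := if_pos ha

lemma mazur_neg {s : ℝ} (hs : 0 < s) (a : ℝ) : mazur s (-a) = -mazur s a := by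
  unfold mazur
  rcases lt_trichotomy a 0 with h | rfl | h
  · rw [if_pos (by linarith), if_neg (by linarith), neg_neg]
  · simp [Real.zero_rpow hs.ne']
  · rw [if_neg (by linarith), if_pos h.le, neg_neg]

/-- Symmetric statements about two reals reduce to `a, b ≥ 0` and to `a, -b ≥ 0`. -/
lemma forall_real_pair_of_symm {Q : ℝ → ℝ → Prop} (hswap : ∀ a b, Q a b → Q b a)
    (hneg : ∀ a b, Q a b → Q (-a) (-b)) (h1 : ∀ a b, 0 ≤ b → b ≤ a → Q a b)
    (h2 : ∀ a b, 0 ≤ b → b ≤ a → Q a (-b)) (a b : ℝ) : Q a b := by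
  have key : ∀ a b, 0 ≤ a → |b| ≤ a → Q a b := by
    intro a b _ hab
    rcases le_total 0 b with hb | hb
    · exact h1 a b hb (abs_of_nonneg hb ▸ hab)
    · have := h2 a (-b) (by linarith) (by rwa [← abs_of_nonpos hb])
      rwa [neg_neg] at this
  have key2 : ∀ a b, |b| ≤ |a| → Q a b := by
    intro a b hab
    rcases le_total 0 a with ha | ha
    · exact key a b ha (by rwa [abs_of_nonneg ha] at hab)
    · have := hneg _ _ (key (-a) (-b) (by linarith) (by rwa [abs_neg, ← abs_of_nonpos ha]))
      rwa [neg_neg, neg_neg] at this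
  rcases le_total |b| |a| with h | h
  · exact key2 a b h
  · exact hswap _ _ (key2 b a h)

/-- Bernoulli's inequality for `b / a`, that is, convexity of the power function at `a`. -/
lemma rpow_sub_rpow_le {s a b : ℝ} (hs : 1 ≤ s) (hb : 0 ≤ b) (hab : b ≤ a) :
    a ^ s - b ^ s ≤ s * a ^ (s - 1) * (a - b) := by
  rcases (hb.trans hab).eq_or_lt with h0 | ha
  · have : b = 0 := le_antisymm (h0 ▸ hab) hb
    simp [← h0, this]
  have h := one_add_mul_self_le_rpow_one_add (s := b / a - 1)
    (by linarith [div_nonneg hb ha.le]) hs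
  rw [add_sub_cancel, Real.div_rpow hb ha.le, le_div_iff₀ (by positivity)] at h
  have e : a ^ s = a ^ (s - 1) * a := by
    rw [← Real.rpow_add_one ha.ne', sub_add_cancel]
  have e2 : (1 + s * (b / a - 1)) * a ^ s = a ^ s + s * a ^ (s - 1) * (b - a) := by
    rw [e]; field_simp
  linarith

lemma abs_mazur_sub_le {s : ℝ} (hs : 1 ≤ s) (a b : ℝ) :
    |mazur s a - mazur s b| ≤ s * max |a| |b| ^ (s - 1) * |a - b| := by
  have hs0 : 0 < s := by linarith
  revert a b
  refine forall_real_pair_of_symm ?_ ?_ ?_ ?_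
  · intro a b h
    rwa [abs_sub_comm, max_comm, abs_sub_comm b]
  · intro a b h
    rw [mazur_neg hs0, mazur_neg hs0, abs_neg, abs_neg, ← neg_sub', ← neg_sub', abs_neg, abs_neg]
    exact h
  · intro a b hb hab
    have ha := hb.trans hab
    rw [mazur_of_nonneg s ha, mazur_of_nonneg s hb, abs_of_nonneg ha, abs_of_nonneg hb,
      max_eq_left hab, abs_of_nonneg (sub_nonneg.2 hab),
      abs_of_nonneg (sub_nonneg.2 (Real.rpow_le_rpow hb hab hs0.le))]
    exact rpow_sub_rpow_le hs hb hab
  · intro a b hb hab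
    have ha := hb.trans hab
    rw [mazur_neg hs0, mazur_of_nonneg s ha, mazur_of_nonneg s hb, abs_neg, abs_of_nonneg ha,
      abs_of_nonneg hb, max_eq_left hab, sub_neg_eq_add, sub_neg_eq_add,
      abs_of_nonneg (add_nonneg ha hb), abs_of_nonneg (by positivity)]
    have e : ∀ t : ℝ, 0 ≤ t → t ^ s = t ^ (s - 1) * t := by
      intro t ht
      rcases ht.eq_or_lt with rfl | ht
      · rw [Real.zero_rpow hs0.ne', mul_zero]
      · rw [← Real.rpow_add_one ht.ne', sub_add_cancel]
    have hle : b ^ (s - 1) ≤ a ^ (s - 1) := Real.rpow_le_rpow hb hab (by linarith)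
    rw [e a ha, e b hb]
    calc a ^ (s - 1) * a + b ^ (s - 1) * b ≤ a ^ (s - 1) * a + a ^ (s - 1) * b := by gcongr
      _ = 1 * a ^ (s - 1) * (a + b) := by ring
      _ ≤ s * a ^ (s - 1) * (a + b) := by gcongr

/-- For equal signs this is superadditivity of the power; for opposite signs it is the power mean
inequality, which is where `2 ^ (s - 1)` arises. -/
lemma abs_sub_rpow_le_mazur {s : ℝ} (hs : 1 ≤ s) (a b : ℝ) :
    |a - b| ^ s ≤ 2 ^ (s - 1) * |mazur s a - mazur s b| := by
  have hs0 : 0 < s := by linarith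
  revert a b
  refine forall_real_pair_of_symm ?_ ?_ ?_ ?_
  · intro a b h
    rwa [abs_sub_comm, abs_sub_comm (mazur s b)]
  · intro a b h
    rw [mazur_neg hs0, mazur_neg hs0, ← neg_sub', ← neg_sub', abs_neg, abs_neg]
    exact h
  · intro a b hb hab
    have ha := hb.trans hab
    have hab' := sub_nonneg.2 hab
    rw [mazur_of_nonneg s ha, mazur_of_nonneg s hb, abs_of_nonneg hab',
      abs_of_nonneg (sub_nonneg.2 (Real.rpow_le_rpow hb hab hs0.le))]
    have h1 := Real.add_rpow_le_rpow_add hab' hb hs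
    rw [sub_add_cancel] at h1
    have h2 : (1 : ℝ) ≤ 2 ^ (s - 1) := Real.one_le_rpow one_le_two (by linarith)
    have h3 : b ^ s ≤ a ^ s := Real.rpow_le_rpow hb hab hs0.le
    nlinarith
  · intro a b hb hab
    have ha := hb.trans hab
    rw [mazur_neg hs0, mazur_of_nonneg s ha, mazur_of_nonneg s hb, sub_neg_eq_add, sub_neg_eq_add,
      abs_of_nonneg (add_nonneg ha hb), abs_of_nonneg (by positivity)]
    exact_mod_cast NNReal.rpow_add_le_mul_rpow_add_rpow ⟨a, ha⟩ ⟨b, hb⟩ hs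

/-! ### The Mazur map between `ℓ_p` norms. -/

/-- The `ℓ_p` norm on `ℝ^d`. -/
noncomputable def lpNorm {d : ℕ} (p : ℝ) (v : Fin d → ℝ) : ℝ := (∑ i, |v i| ^ p) ^ (1 / p)

variable {d : ℕ}

lemma sum_rpow_nonneg (p : ℝ) (v : Fin d → ℝ) : 0 ≤ ∑ i, |v i| ^ p :=
  Finset.sum_nonneg fun _ _ => Real.rpow_nonneg (abs_nonneg _) _

lemma lpNorm_nonneg (p : ℝ) (v : Fin d → ℝ) : 0 ≤ lpNorm p v :=
  Real.rpow_nonneg (sum_rpow_nonneg p v) _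

lemma lpNorm_zero {p : ℝ} (hp : 0 < p) : lpNorm p (0 : Fin d → ℝ) = 0 := by
  simp [lpNorm, Real.zero_rpow hp.ne', Real.zero_rpow (inv_ne_zero hp.ne')]

lemma lpNorm_smul {p : ℝ} (hp : 0 < p) {c : ℝ} (hc : 0 ≤ c) (v : Fin d → ℝ) :
    lpNorm p (c • v) = c * lpNorm p v := by
  unfold lpNorm
  have : ∀ i, |(c • v) i| ^ p = c ^ p * |v i| ^ p := by
    intro i
    rw [Pi.smul_apply, smul_eq_mul, abs_mul, abs_of_nonneg hc, Real.mul_rpow hc (abs_nonneg _)]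
  rw [Finset.sum_congr rfl fun i _ => this i, ← Finset.mul_sum,
    Real.mul_rpow (by positivity) (sum_rpow_nonneg p v), ← Real.rpow_mul hc,
    mul_one_div_cancel hp.ne', Real.rpow_one]

lemma sum_rpow_le_one {p : ℝ} (hp : 0 < p) {v : Fin d → ℝ} (h : lpNorm p v ≤ 1) :
    ∑ i, |v i| ^ p ≤ 1 := by
  have h1 : lpNorm p v ^ p ≤ 1 := Real.rpow_le_one (lpNorm_nonneg p v) h hp.le
  rwa [lpNorm, ← Real.rpow_mul (sum_rpow_nonneg p v), one_div_mul_cancel hp.ne',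
    Real.rpow_one] at h1

/-- Hölder's inequality with exponents `s` and `s / (s - 1)` separates the differences from the
factor `max |x i| |y i|`, whose `p`-th powers sum to at most `2` on the unit ball. -/
lemma lpNorm_mazur_sub_le {p q s : ℝ} (hs : 1 < s) (hq : 0 < q) (hp : p = s * q)
    {x y : Fin d → ℝ} (hx : lpNorm p x ≤ 1) (hy : lpNorm p y ≤ 1) :
    lpNorm q (fun i => mazur s (x i) - mazur s (y i)) ≤
      s * 2 ^ (1 / q - 1 / p) * lpNorm p (x - y) := by
  have hs0 : 0 < s := by linarith
  have hs1 : 0 < s - 1 := by linarith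
  have hp0 : 0 < p := by rw [hp]; positivity
  have hconj : s.HolderConjugate (s / (s - 1)) := Real.HolderConjugate.conjExponent hs
  set m : Fin d → ℝ := fun i => max |x i| |y i| with hm
  have hm0 : ∀ i, 0 ≤ m i := fun i => le_max_of_le_left (abs_nonneg _)
  have hmp : ∑ i, m i ^ p ≤ 2 := by
    calc ∑ i, m i ^ p ≤ ∑ i, (|x i| ^ p + |y i| ^ p) := by
          refine Finset.sum_le_sum fun i _ => ?_
          have h1 : 0 ≤ |x i| ^ p := by positivity
          have h2 : 0 ≤ |y i| ^ p := by positivity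
          rcases max_cases |x i| |y i| with h | h <;> simp only [hm, h.1] <;> linarith
      _ ≤ 2 := by
          rw [Finset.sum_add_distrib]
          linarith [sum_rpow_le_one hp0 hx, sum_rpow_le_one hp0 hy]
  have hmp0 : 0 ≤ ∑ i, m i ^ p := Finset.sum_nonneg fun i _ => Real.rpow_nonneg (hm0 i) _
  set T := ∑ i, |(x - y) i| ^ p with hT
  have hT0 : 0 ≤ T := sum_rpow_nonneg p _
  have hsum : ∑ i, |mazur s (x i) - mazur s (y i)| ^ q ≤
      s ^ q * (T ^ (1 / s) * 2 ^ (1 - 1 / s)) := by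
    calc ∑ i, |mazur s (x i) - mazur s (y i)| ^ q
        ≤ ∑ i, s ^ q * (|(x - y) i| ^ q * m i ^ ((s - 1) * q)) := by
          refine Finset.sum_le_sum fun i _ => ?_
          calc |mazur s (x i) - mazur s (y i)| ^ q
              ≤ (s * m i ^ (s - 1) * |x i - y i|) ^ q :=
                Real.rpow_le_rpow (abs_nonneg _) (abs_mazur_sub_le hs.le _ _) hq.le
            _ = _ := by
                have := Real.rpow_nonneg (hm0 i) (s - 1)
                rw [Real.mul_rpow (by positivity) (abs_nonneg _), Real.mul_rpow hs0.le this,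
                  ← Real.rpow_mul (hm0 i), Pi.sub_apply]
                ring
      _ = s ^ q * ∑ i, |(x - y) i| ^ q * m i ^ ((s - 1) * q) := by rw [Finset.mul_sum]
      _ ≤ s ^ q * ((∑ i, (|(x - y) i| ^ q) ^ s) ^ (1 / s) *
            (∑ i, (m i ^ ((s - 1) * q)) ^ (s / (s - 1))) ^ (1 / (s / (s - 1)))) := by
          gcongr
          exact Real.inner_le_Lp_mul_Lq_of_nonneg _ hconj
            (fun i _ => Real.rpow_nonneg (abs_nonneg _) _)
            (fun i _ => Real.rpow_nonneg (hm0 i) _)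
      _ = s ^ q * (T ^ (1 / s) * (∑ i, m i ^ p) ^ (1 - 1 / s)) := by
          have e1 : ∀ i, (|(x - y) i| ^ q) ^ s = |(x - y) i| ^ p := fun i => by
            rw [← Real.rpow_mul (abs_nonneg _), hp, mul_comm]
          have e2 : ∀ i, (m i ^ ((s - 1) * q)) ^ (s / (s - 1)) = m i ^ p := fun i => by
            rw [← Real.rpow_mul (hm0 i), hp]
            congr 1
            field_simp
          have e3 : 1 / (s / (s - 1)) = 1 - 1 / s := by field_simp
          simp only [e1, e2, e3, hT]
      _ ≤ _ := by
          have : 0 ≤ 1 - 1 / s := by rw [sub_nonneg, div_le_one hs0]; exact hs.le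
          gcongr
  calc lpNorm q (fun i => mazur s (x i) - mazur s (y i))
      ≤ (s ^ q * (T ^ (1 / s) * 2 ^ (1 - 1 / s))) ^ (1 / q) :=
        Real.rpow_le_rpow (sum_rpow_nonneg q _) hsum (by positivity)
    _ = s * (T ^ (1 / p) * 2 ^ (1 / q - 1 / p)) := by
        rw [Real.mul_rpow (by positivity) (by positivity),
          Real.mul_rpow (by positivity) (by positivity), ← Real.rpow_mul hs0.le,
          ← Real.rpow_mul hT0, ← Real.rpow_mul zero_le_two, mul_one_div_cancel hq.ne',
          Real.rpow_one]
        congr 3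
        · rw [hp]; field_simp
        · rw [hp]; field_simp
    _ = _ := by rw [lpNorm]; ring

lemma lpNorm_sub_le_mazur {p q s : ℝ} (hs : 1 < s) (hq : 0 < q) (hp : p = s * q)
    (x y : Fin d → ℝ) :
    lpNorm p (x - y) ≤
      2 ^ (1 - 1 / s) * lpNorm q (fun i => mazur s (x i) - mazur s (y i)) ^ (1 / s) := by
  have hs0 : 0 < s := by linarith
  have hp0 : 0 < p := by rw [hp]; positivity
  set U := ∑ i, |mazur s (x i) - mazur s (y i)| ^ q with hU
  have hU0 : 0 ≤ U := sum_rpow_nonneg q (fun i => mazur s (x i) - mazur s (y i))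
  have hsum : ∑ i, |(x - y) i| ^ p ≤ 2 ^ ((s - 1) * q) * U := by
    rw [hU, Finset.mul_sum]
    refine Finset.sum_le_sum fun i _ => ?_
    rw [hp, Real.rpow_mul (abs_nonneg _), Real.rpow_mul zero_le_two,
      ← Real.mul_rpow (by positivity) (abs_nonneg _)]
    exact Real.rpow_le_rpow (by positivity) (abs_sub_rpow_le_mazur hs.le _ _) hq.le
  calc lpNorm p (x - y) ≤ (2 ^ ((s - 1) * q) * U) ^ (1 / p) :=
        Real.rpow_le_rpow (sum_rpow_nonneg p _) hsum (by positivity)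
    _ = 2 ^ (1 - 1 / s) * (U ^ (1 / q)) ^ (1 / s) := by
        rw [Real.mul_rpow (by positivity) hU0, ← Real.rpow_mul zero_le_two, ← Real.rpow_mul hU0]
        congr 2
        · rw [hp]; field_simp
        · rw [hp]; field_simp

/-! ### Transfer from `ℓ_q` to `ℓ_p` and induction on the exponent. -/

/-- All sets of at most `n` points of `ℓ_p^d` have Lipschitz decompositions with parameter `b` at
all scales. -/
def Separable (p : ℝ) (n d : ℕ) (b : ℝ) : Prop :=
  ∀ (ι : Type) [Fintype ι], Fintype.card ι ≤ n → ∀ (f : ι → Fin d → ℝ) (Δ : ℝ), 0 < Δ →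
    Decomposable (fun x y => lpNorm p (f x - f y) ≤ Δ)
      (fun x y => ENNReal.ofReal (b * lpNorm p (f x - f y) / Δ))

lemma Separable.mono {p : ℝ} {n : ℕ} {b b' : ℝ} (h : Separable p n d b) (hb : b ≤ b') :
    Separable p n d b' := by
  intro ι _ hι f Δ hΔ
  refine (h ι hι f Δ hΔ).mono (fun _ _ h => h) fun x y => ENNReal.ofReal_le_ofReal ?_
  have := lpNorm_nonneg p (f x - f y)
  gcongr

lemma Separable.of_mazur {p q s b : ℝ} {n : ℕ} (hs : 1 < s) (hs2 : s ≤ 2) (hq : 0 < q)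
    (hp : p = s * q) (hb : 0 ≤ b) (h : Separable q n d b) :
    Separable p n d (16 * 2 ^ (1 / q - 1 / p) * b) := by
  classical
  intro ι _ hι f Δ₀ hΔ₀
  have hs0 : 0 < s := by linarith
  have hp0 : 0 < p := by rw [hp]; positivity
  set L : ℝ := 2 ^ (1 / q - 1 / p) with hL
  have hL0 : 0 < L := by positivity
  have key : ∀ (m : ℕ) (Δ : ℝ), 0 < Δ → (∀ x y, lpNorm p (f x - f y) ≤ 2 ^ m * Δ) →
      Decomposable (fun x y => lpNorm p (f x - f y) ≤ Δ)
        -- The constant does not grow with `m`: the partition at scale `2 * Δ` contributes `8 * L *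
        -- b / Δ` per unit of distance, and the refinement the same again.
        (fun x y => ENNReal.ofReal (16 * L * b * lpNorm p (f x - f y) / Δ)) := by
    intro m
    induction m with
    | zero =>
      intro Δ _ hdiam
      refine decomposable_of_forall_close _ fun x y => ?_
      simpa using hdiam x y
    | succ m ih =>
      intro Δ hΔ hdiam
      have h1 := ih (2 * Δ) (by positivity) fun x y => (hdiam x y).trans_eq (by ring)
      refine (h1.refine (close' := fun x y => lpNorm p (f x - f y) ≤ Δ)
        (sep' := fun x y => ENNReal.ofReal (8 * L * b * lpNorm p (f x - f y) / Δ)) ?_).mono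
        (fun _ _ h => h) ?_
      · intro c
        let u : ι → Fin d → ℝ := fun x => (2 * Δ)⁻¹ • (f x - f c)
        let F : ι → Fin d → ℝ := fun x i => mazur s (u x i)
        have hu : ∀ x, lpNorm p (f x - f c) ≤ 2 * Δ → lpNorm p (u x) ≤ 1 := by
          intro x hx
          rw [lpNorm_smul hp0 (by positivity), inv_mul_le_one₀ (by positivity)]
          exact hx
        have huu : ∀ x y, lpNorm p (u x - u y) = (2 * Δ)⁻¹ * lpNorm p (f x - f y) := by
          intro x y
          rw [← lpNorm_smul hp0 (by positivity), ← smul_sub, sub_sub_sub_cancel_right]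
        -- This solves `2 ^ (1 - 1 / s) * δ ^ (1 / s) = 1 / 2`, so the Hölder inverse halves the
        -- scale `2 * Δ`; its inverse is at most `8` because `s ≤ 2`.
        set δ : ℝ := 2 ^ (-(2 * s - 1)) with hδ
        have hδ0 : 0 < δ := by positivity
        refine (h ι hι F δ hδ0).mono ?_ ?_
        · intro x y hxy _ _
          have h2 := lpNorm_sub_le_mazur hs hq hp (u x) (u y)
          have h3 : lpNorm q (fun i => mazur s (u x i) - mazur s (u y i)) ^ (1 / s) ≤
              δ ^ (1 / s) := Real.rpow_le_rpow (lpNorm_nonneg _ _) hxy (by positivity)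
          have h4 : (2 : ℝ) ^ (1 - 1 / s) * δ ^ (1 / s) = 2⁻¹ := by
            rw [hδ, ← Real.rpow_mul zero_le_two, ← Real.rpow_add two_pos, ← Real.rpow_neg_one]
            congr 1
            field_simp
            ring
          have h5 : lpNorm p (u x - u y) ≤ 2⁻¹ :=
            h2.trans ((mul_le_mul_of_nonneg_left h3 (by positivity)).trans_eq h4)
          rw [huu, inv_mul_le_iff₀ (by positivity)] at h5
          linarith
        · intro x y
          split_ifs with hxy
          · refine ENNReal.ofReal_le_ofReal ?_
            have h2 := lpNorm_mazur_sub_le hs hq hp (hu x hxy.1) (hu y hxy.2)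
            rw [huu] at h2
            have h6 : δ⁻¹ ≤ 8 := by
              rw [hδ, ← Real.rpow_neg zero_le_two, neg_neg]
              calc (2 : ℝ) ^ (2 * s - 1) ≤ 2 ^ (3 : ℝ) :=
                    Real.rpow_le_rpow_of_exponent_le one_le_two (by linarith)
                _ = 8 := by norm_num
            have hN := lpNorm_nonneg p (f x - f y)
            calc b * lpNorm q (F x - F y) / δ = b * lpNorm q (F x - F y) * δ⁻¹ := by
                  rw [div_eq_mul_inv]
              _ ≤ b * (s * L * ((2 * Δ)⁻¹ * lpNorm p (f x - f y))) * δ⁻¹ := by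
                  gcongr
                  exact h2
              _ ≤ b * (2 * L * ((2 * Δ)⁻¹ * lpNorm p (f x - f y))) * 8 := by gcongr
              _ = 8 * L * b * lpNorm p (f x - f y) / Δ := by field_simp
          · exact le_top
      · intro x y
        have hN := lpNorm_nonneg p (f x - f y)
        rw [← ENNReal.ofReal_add (by positivity) (by positivity)]
        refine ENNReal.ofReal_le_ofReal (le_of_eq ?_)
        field_simp
        ring
  obtain ⟨R, hR⟩ := (Set.finite_range fun z : ι × ι => lpNorm p (f z.1 - f z.2)).bddAbove
  obtain ⟨m, hm⟩ := pow_unbounded_of_one_lt (R / Δ₀) one_lt_two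
  refine key m Δ₀ hΔ₀ fun x y => ?_
  refine (hR ⟨(x, y), rfl⟩).trans ?_
  rw [div_lt_iff₀ hΔ₀] at hm
  exact hm.le

lemma separable_of_two {n : ℕ} {b : ℝ} (hb : 0 ≤ b) (h : Separable 2 n d b) (k : ℕ) :
    ∀ p : ℝ, 2 ≤ p → p ≤ 2 ^ (k + 2) → Separable p n d (p ^ 4 * 2 ^ (1 / 2 - 1 / p) * b) := by
  have small : ∀ p : ℝ, 2 ≤ p → p ≤ 4 →
      Separable p n d (p ^ 4 * 2 ^ (1 / 2 - 1 / p) * b) := by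
    intro p hp2 hp4
    rcases hp2.eq_or_lt with rfl | hlt
    · refine h.mono ?_
      norm_num
      linarith
    · refine (h.of_mazur (p := p) (s := p / 2) (by linarith) (by linarith) two_pos
        (by ring) hb).mono ?_
      have : (16 : ℝ) ≤ p ^ 4 := by
        calc (16 : ℝ) = 2 ^ 4 := by norm_num
          _ ≤ p ^ 4 := by gcongr
      gcongr
  induction k with
  | zero => intro p hp2 hp4; exact small p hp2 (by norm_num at hp4; exact hp4)
  | succ k ih =>
    intro p hp2 hpk
    rcases le_total p 4 with hp4 | hp4
    · exact small p hp2 hp4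
    · have hq := ih (p / 2) (by linarith) (by rw [pow_succ] at hpk; linarith)
      refine (hq.of_mazur (p := p) (s := 2) one_lt_two le_rfl (by linarith) (by ring)
        (by positivity)).mono (le_of_eq ?_)
      -- The powers of two telescope, and `16 * (p / 2) ^ 4 = p ^ 4`.
      have : (2 : ℝ) ^ (1 / 2 - 1 / p) = 2 ^ (1 / (p / 2) - 1 / p) * 2 ^ (1 / 2 - 1 / (p / 2)) := by
        rw [← Real.rpow_add two_pos]
        congr 1
        ring
      rw [this]
      ring

lemma separable_two (n : ℕ) (hd : 1 ≤ d) :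
    Separable 2 n d (2048 * √(min (Real.log n) d)) := by
  intro ι _ hι f Δ hΔ
  -- For `n ≤ 1` the logarithm, hence the parameter, is zero, but the one-cluster partition
  -- separates nothing.
  rcases Nat.lt_or_ge n 2 with hn | hn
  · have : Subsingleton ι := Fintype.card_le_one_iff_subsingleton.1 (by omega)
    refine decomposable_of_forall_close _ fun x y => ?_
    rw [Subsingleton.elim x y, sub_self, lpNorm_zero two_pos]
    exact hΔ.le
  have hnorm : ∀ x y, lpNorm 2 (f x - f y) =
      ‖(WithLp.toLp 2 (f x) : EuclideanSpace ℝ (Fin d)) - WithLp.toLp 2 (f y)‖ := by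
    intro x y
    rw [EuclideanSpace.norm_eq, Real.sqrt_eq_rpow, lpNorm]
    simp
  simp only [hnorm]
  rcases le_total (Real.log n) d with h | h
  · rw [min_eq_left h]
    exact decomposable_euclidean_log hn hι _ hΔ
  · rw [min_eq_right h]
    refine (decomposable_euclidean (fun x => (WithLp.toLp 2 (f x) : EuclideanSpace ℝ (Fin d)))
      hd (by simp) hΔ).mono (fun _ _ h => h) fun x y => ENNReal.ofReal_le_ofReal ?_
    gcongr
    norm_num

end Mazur

/-! ### Conclusion in the metric space. -/

lemma exists_isLipschitzDecomposition {M : Type*} [MetricSpace M] {β Δ : ℝ}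
    (h : Decomposable (fun x y : M => dist x y ≤ Δ)
      (fun x y => ENNReal.ofReal (β * dist x y / Δ))) (hβ : 0 ≤ β) (hΔ : 0 < Δ) :
    ∃ D : PMF (Setoid M), IsLipschitzDecomposition β Δ D := by
  obtain ⟨D, h1, h2⟩ := h
  refine ⟨D, ?_, ?_⟩
  · rintro P hP K ⟨z, rfl⟩
    refine Metric.ediam_le fun x hx y hy => ?_
    rw [edist_dist]
    exact ENNReal.ofReal_le_ofReal (h1 P hP x y (P.trans hx (P.symm hy)))
  · intro x y
    refine ENNReal.toReal_le_of_le_ofReal (by positivity) ?_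
    rw [← mul_div_assoc]
    refine le_trans (MeasureTheory.measure_mono (t := {P | ¬ P x y}) fun P hP hxy => hP ?_) (h2 x y)
    ext w
    exact ⟨fun hw => P.trans hw hxy, fun hw => P.trans hw (P.symm hxy)⟩

end LipDecomp

theorem mainTheorem1 :
    ∃ C : ℝ, 0 < C ∧
      ∀ (p : ℝ≥0) [Fact ((1 : ℝ≥0∞) ≤ p)], 2 ≤ p →
      ∀ d : ℕ, 1 ≤ d →
      ∀ (n : ℕ) (S : Finset (PiLp (p : ℝ≥0∞) (fun _ : Fin d => ℝ))), S.card = n →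
      ∀ Δ : ℝ, 0 < Δ →
        ∃ D : PMF (Setoid S),
          LipDecomp.IsLipschitzDecomposition
            (C * (p : ℝ) ^ 4 * Real.sqrt (min (Real.log n) (d : ℝ))) Δ D := by
  -- The constant is `2048` from the Euclidean case times a bound `2` for `2 ^ (1 / 2 - 1 / p)`.
  refine ⟨4096, by norm_num, fun p _ hp d hd n S hS Δ hΔ => ?_⟩
  have hp2 : (2 : ℝ) ≤ p := by exact_mod_cast hp
  refine LipDecomp.exists_isLipschitzDecomposition ?_ (by positivity) hΔ
  have hdist : ∀ x y : S, dist x y = LipDecomp.lpNorm (p : ℝ) (x.1.ofLp - y.1.ofLp) := by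
    intro x y
    rw [Subtype.dist_eq, PiLp.dist_eq_sum (by simpa using (by linarith : (0 : ℝ) < p))]
    rfl
  obtain ⟨k, hk⟩ := pow_unbounded_of_one_lt (p : ℝ) one_lt_two
  have hpk : (p : ℝ) ≤ 2 ^ (k + 2) :=
    hk.le.trans (pow_le_pow_right₀ one_le_two (by omega))
  have hsep := LipDecomp.separable_of_two (by positivity) (LipDecomp.separable_two n hd) k p hp2 hpk
  simp only [hdist]
  refine (hsep S (by simp [hS]) (fun x => x.1.ofLp) Δ hΔ).mono (fun _ _ h => h) fun x y =>
    ENNReal.ofReal_le_ofReal ?_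
  have hN := LipDecomp.lpNorm_nonneg (p : ℝ) (x.1.ofLp - y.1.ofLp)
  have h2 : (2 : ℝ) ^ (1 / 2 - 1 / (p : ℝ)) ≤ 2 := by
    calc (2 : ℝ) ^ (1 / 2 - 1 / (p : ℝ)) ≤ 2 ^ (1 : ℝ) := by
          refine Real.rpow_le_rpow_of_exponent_le one_le_two ?_
          have : 0 ≤ 1 / (p : ℝ) := by positivity
          linarith
      _ = 2 := Real.rpow_one 2
  calc _ ≤ (p : ℝ) ^ 4 * 2 * (2048 * √(min (Real.log n) d)) *
        LipDecomp.lpNorm (p : ℝ) (x.1.ofLp - y.1.ofLp) / Δ := by gcongr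
    _ = _ := by ring
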